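/- For $S_1\in\mathbb R^{m_1\times n_1}$ and $S_2\in\mathbb R^{m_2\times n_2}$, the 1-product $S_1\otimes S_2\in\mathbb R^{(m_1+m_2)\times(n_1n_2)}$ is the matrix whose column with index $(k-1)n_2+\ell$ (where $1\le k\le n_1$, $1\le \ell\le n_2$) is the $k$-th column of $S_1$ stacked on top of the $\ell$-th column of $S_2$. Two matrices are isomorphic if one can be obtained from the other by permuting rows and columns. A matrix $S$ is a 1-product if it is isomorphic to $S_1\otimes S_2$ for some non-empty matrices $S_1,S_2$, that is, matrices with at least one row and at least one column. Theorem. There is an algorithm, namely a single real RAM program (using the constants $0,1$, exact real arithmetic $+,-,\cdot,/$ and comparisons of reals at unit cost, and natural-number indices with addition, truncated subtraction, comparison and indirect addressing, without any conversion of reals to natural numbers), and a polynomial $p$ in two variables such that, for all $m,n$, given any $S\in\mathbb R^{m\times n}$, the program halts after at most $p(m,n)$ steps, correctly determines whether $S$ is a 1-product, and, in case it is, outputs two non-empty matrices $S_1,S_2$ such that $S_1\otimes S_2$ is isomorphic to $S$. -/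

import Mathlib

/-! ### The 1-product of matrices -/

/-- The 1-product: column `k * n₂ + l` (0-based) is column `k` of `S₁` on top of column `l`
of `S₂`. -/
def oneProd {m₁ n₁ m₂ n₂ : ℕ} (S₁ : Matrix (Fin m₁) (Fin n₁) ℝ)
    (S₂ : Matrix (Fin m₂) (Fin n₂) ℝ) : Matrix (Fin (m₁ + m₂)) (Fin (n₁ * n₂)) ℝ :=
  Matrix.of fun i j =>
    Fin.addCases (fun i₁ => S₁ i₁ j.divNat) (fun i₂ => S₂ i₂ j.modNat) i

/-- Two matrices are isomorphic if one is obtained from the other by permuting rows and columns.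
The sizes are allowed to differ as expressions; the two bijections force them to be equal. -/
def MatIso {m n m' n' : ℕ} (A : Matrix (Fin m) (Fin n) ℝ) (B : Matrix (Fin m') (Fin n') ℝ) :
    Prop :=
  ∃ (e : Fin m ≃ Fin m') (f : Fin n ≃ Fin n'), ∀ i j, A i j = B (e i) (f j)

/-- `S` is a 1-product: it is isomorphic to `S₁ ⊗ S₂` for two non-empty matrices (matrices with
at least one row and at least one column). -/
def IsOneProduct {m n : ℕ} (S : Matrix (Fin m) (Fin n) ℝ) : Prop :=
  ∃ (m₁ n₁ m₂ n₂ : ℕ) (S₁ : Matrix (Fin m₁) (Fin n₁) ℝ) (S₂ : Matrix (Fin m₂) (Fin n₂) ℝ),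
    0 < m₁ ∧ 0 < n₁ ∧ 0 < m₂ ∧ 0 < n₂ ∧ MatIso S (oneProd S₁ S₂)

/-! ### Real RAM programs with a step count

A program is a finite text acting on an unbounded memory which holds natural numbers and real
numbers. Natural numbers serve for counting and for addressing; the only operations on them are
addition, truncated subtraction and comparison, so that within `t` steps only numbers of `O(t)`
more bits than the initial ones can be produced. On real numbers there are exact field operations
and comparison, at unit cost; the only constants are `0` and `1`, and there is no rounding and no
conversion from real numbers to natural numbers. Every operation, memory access, assignment and
test is charged. -/

namespace RealRAM

/-- The memory. Variables and arrays are named by natural numbers, which are fixed in the text of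
a program; array cells are addressed by pairs of natural numbers, which a program can compute. -/
structure State where
  /-- natural-number variables -/
  var : ℕ → ℕ
  /-- natural-number arrays: name, row index, column index -/
  arr : ℕ → ℕ → ℕ → ℕ
  /-- real variables -/
  rvar : ℕ → ℝ
  /-- real arrays: name, row index, column index -/
  rarr : ℕ → ℕ → ℕ → ℝ

/-- Natural-number expressions. -/
inductive NExp where
  | const (c : ℕ)
  | var (x : ℕ)
  | get (a : ℕ) (i j : NExp)
  | add (e f : NExp)
  | sub (e f : NExp)

/-- The value of a natural-number expression (`sub` is truncated subtraction). -/
def NExp.eval (s : State) : NExp → ℕ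
  | .const c => c
  | .var x => s.var x
  | .get a i j => s.arr a (i.eval s) (j.eval s)
  | .add e f => e.eval s + f.eval s
  | .sub e f => e.eval s - f.eval s

/-- The cost of evaluating a natural-number expression: its number of nodes. -/
def NExp.cost : NExp → ℕ
  | .const _ => 1
  | .var _ => 1
  | .get _ i j => i.cost + j.cost + 1
  | .add e f => e.cost + f.cost + 1
  | .sub e f => e.cost + f.cost + 1

/-- Real expressions. -/
inductive RExp where
  | zero
  | one
  | var (x : ℕ)
  | get (a : ℕ) (i j : NExp)
  | add (e f : RExp)
  | sub (e f : RExp)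
  | mul (e f : RExp)
  | div (e f : RExp)

/-- The value of a real expression (division by zero returns `0`). -/
noncomputable def RExp.eval (s : State) : RExp → ℝ
  | .zero => 0
  | .one => 1
  | .var x => s.rvar x
  | .get a i j => s.rarr a (i.eval s) (j.eval s)
  | .add e f => e.eval s + f.eval s
  | .sub e f => e.eval s - f.eval s
  | .mul e f => e.eval s * f.eval s
  | .div e f => e.eval s / f.eval s

/-- The cost of evaluating a real expression: its number of nodes. -/
def RExp.cost : RExp → ℕ
  | .zero => 1
  | .one => 1
  | .var _ => 1
  | .get _ i j => i.cost + j.cost + 1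
  | .add e f => e.cost + f.cost + 1
  | .sub e f => e.cost + f.cost + 1
  | .mul e f => e.cost + f.cost + 1
  | .div e f => e.cost + f.cost + 1

/-- Tests: comparisons of natural numbers and of real numbers, and Boolean combinations. -/
inductive Test where
  | nle (e f : NExp)
  | neq (e f : NExp)
  | rle (e f : RExp)
  | req (e f : RExp)
  | not (b : Test)
  | and (b c : Test)

/-- The outcome of a test. In the names, `nle` and `neq` are `≤` and `=` of natural numbers, and
`rle` and `req` are `≤` and `=` of real numbers. -/
def Test.Holds (s : State) : Test → Prop
  | .nle e f => e.eval s ≤ f.eval s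
  | .neq e f => e.eval s = f.eval s
  | .rle e f => e.eval s ≤ f.eval s
  | .req e f => e.eval s = f.eval s
  | .not b => ¬ b.Holds s
  | .and b c => b.Holds s ∧ c.Holds s

/-- The cost of a test. -/
def Test.cost : Test → ℕ
  | .nle e f => e.cost + f.cost + 1
  | .neq e f => e.cost + f.cost + 1
  | .rle e f => e.cost + f.cost + 1
  | .req e f => e.cost + f.cost + 1
  | .not b => b.cost + 1
  | .and b c => b.cost + c.cost + 1

/-- Programs. -/
inductive Program where
  | skip
  /-- `x := e` for a natural-number variable -/
  | set (x : ℕ) (e : NExp)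
  /-- `a[i, j] := e` for a natural-number array -/
  | put (a : ℕ) (i j e : NExp)
  /-- `x := e` for a real variable -/
  | rset (x : ℕ) (e : RExp)
  /-- `a[i, j] := e` for a real array -/
  | rput (a : ℕ) (i j : NExp) (e : RExp)
  | seq (p q : Program)
  | ite (b : Test) (p q : Program)
  | while (b : Test) (p : Program)

/-- Writing a natural number into a variable. -/
def State.setVar (s : State) (x v : ℕ) : State :=
  { s with var := fun y => if y = x then v else s.var y }

/-- Writing a natural number into an array cell. -/
def State.setArr (s : State) (a i j v : ℕ) : State :=
  { s with arr := fun b k l => if b = a ∧ k = i ∧ l = j then v else s.arr b k l }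

/-- Writing a real number into a variable. -/
noncomputable def State.setRVar (s : State) (x : ℕ) (v : ℝ) : State :=
  { s with rvar := fun y => if y = x then v else s.rvar y }

/-- Writing a real number into an array cell. -/
noncomputable def State.setRArr (s : State) (a i j : ℕ) (v : ℝ) : State :=
  { s with rarr := fun b k l => if b = a ∧ k = i ∧ l = j then v else s.rarr b k l }

/-- `Exec p s t s'`: started in the memory `s`, the program `p` halts after exactly `t` steps with
the memory `s'`. Execution is deterministic; a program that runs forever has no such `t`, `s'`. -/
inductive Exec : Program → State → ℕ → State → Prop where
  | skip (s : State) : Exec .skip s 1 s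
  | set (s : State) (x : ℕ) (e : NExp) :
      Exec (.set x e) s (e.cost + 1) (s.setVar x (e.eval s))
  | put (s : State) (a : ℕ) (i j e : NExp) :
      Exec (.put a i j e) s (i.cost + j.cost + e.cost + 1)
        (s.setArr a (i.eval s) (j.eval s) (e.eval s))
  | rset (s : State) (x : ℕ) (e : RExp) :
      Exec (.rset x e) s (e.cost + 1) (s.setRVar x (e.eval s))
  | rput (s : State) (a : ℕ) (i j : NExp) (e : RExp) :
      Exec (.rput a i j e) s (i.cost + j.cost + e.cost + 1)
        (s.setRArr a (i.eval s) (j.eval s) (e.eval s))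
  | seq {p q : Program} {s s' s'' : State} {t t' : ℕ} :
      Exec p s t s' → Exec q s' t' s'' → Exec (.seq p q) s (t + t') s''
  | iteTrue {b : Test} {p q : Program} {s s' : State} {t : ℕ} :
      b.Holds s → Exec p s t s' → Exec (.ite b p q) s (b.cost + t) s'
  | iteFalse {b : Test} {p q : Program} {s s' : State} {t : ℕ} :
      ¬ b.Holds s → Exec q s t s' → Exec (.ite b p q) s (b.cost + t) s'
  | whileFalse {b : Test} {p : Program} {s : State} :
      ¬ b.Holds s → Exec (.while b p) s b.cost s
  | whileTrue {b : Test} {p : Program} {s s' s'' : State} {t t' : ℕ} :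
      b.Holds s → Exec p s t s' → Exec (.while b p) s' t' s'' →
      Exec (.while b p) s (b.cost + t + t') s''

/-- The initial memory for an input matrix: the natural-number variables `0` and `1` hold the
numbers of rows and columns, the real array `0` holds the entries (indices start at `0`), and
everything else is `0`. -/
noncomputable def input {m n : ℕ} (S : Matrix (Fin m) (Fin n) ℝ) : State where
  var := fun x => if x = 0 then m else if x = 1 then n else 0
  arr := fun _ _ _ => 0
  rvar := fun _ => 0
  rarr := fun a i j => if h : a = 0 ∧ i < m ∧ j < n then S ⟨i, h.2.1⟩ ⟨j, h.2.2⟩ else 0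

/-- The `m × n` matrix in the top left corner of the real array `a`. -/
def State.matrix (s : State) (a m n : ℕ) : Matrix (Fin m) (Fin n) ℝ :=
  Matrix.of fun i j => s.rarr a i j

end RealRAM

/-- The memory `s` holds a correct answer for `S`. The natural-number variable `0` holds `1` if `S`
is a 1-product and `0` if it is not. If it is one, then moreover the variables `1`, `2` hold the
size of a non-empty matrix stored in the real array `1`, the variables `3`, `4` hold the size of a
non-empty matrix stored in the real array `2`, and the 1-product of these is isomorphic to `S`. -/
def CorrectAnswer {m n : ℕ} (S : Matrix (Fin m) (Fin n) ℝ) (s : RealRAM.State) : Prop :=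
  (¬ IsOneProduct S → s.var 0 = 0) ∧
  (IsOneProduct S → s.var 0 = 1 ∧
    0 < s.var 1 ∧ 0 < s.var 2 ∧ 0 < s.var 3 ∧ 0 < s.var 4 ∧
    MatIso S (oneProd (s.matrix 1 (s.var 1) (s.var 2)) (s.matrix 2 (s.var 3) (s.var 4))))

/-! Pick a column of `S` uniformly at random. In a 1-product its top and bottom parts are
independent, because the columns run through all pairs. Conversely, let the rows split into nonempty
sets A and B whose parts are independent, and let f(x), g(y) be the multiplicities of the A-part of
column x and of the B-part of column y. Independence gives n ∣ f(x) g(y). If d is the gcd of all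
f(x), then n ∣ d g(y), so e = n/d divides every g(y). Keeping one in d columns of each A-class and
one in e of each B-class gives factors with e and d columns and the right multiplicities. Hence
1-products are exactly the matrices with a nontrivial independent splitting of the rows
(`IsOneProduct.exists_rowIndep`, `RowIndep.exists_dvd`, `matIso_of_selected`).

To avoid trying all subsets, A is grown from row 0. While A depends on the other rows, let v be
least such that A depends on the rows outside A up to v. Every Z ⊇ A that splits off contains v:
otherwise the decomposition and contraction rules would make A independent of those rows
(`RowIndep.mem_of_not_insert`). So A ends as the least splitting set containing row 0, and `S` is a
1-product iff rows remain outside it (`grow_spec`). The number d is then found by trying 1, …, n.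

All loops count up to m or n, so a fixed program has bounded nesting depth and runs in polynomial
time (`Code.exec_compile`). Correctness is proved on the functional semantics `Code.run` with loop
invariants (`Code.loop_induction`) and frame conditions. -/

namespace RealRAM

/-! ### Programs with counting loops: semantics and polynomial running time. -/

/-- Programs in which the only iteration is counting: `loop c b p` runs `p` for
`c = 0, 1, …, b - 1`, where `b` is one of the variables `0` and `1`. -/
inductive Code where
  | skip
  | set (x : ℕ) (e : NExp)
  | put (a : ℕ) (i j e : NExp)
  | rset (x : ℕ) (e : RExp)
  | rput (a : ℕ) (i j : NExp) (e : RExp)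
  | seq (p q : Code)
  | ite (b : Test) (p q : Code)
  | loop (c b : ℕ) (p : Code)

namespace Code

/-- The program of a code. -/
def compile : Code → Program
  | .skip => .skip
  | .set x e => .set x e
  | .put a i j e => .put a i j e
  | .rset x e => .rset x e
  | .rput a i j e => .rput a i j e
  | .seq p q => .seq p.compile q.compile
  | .ite b p q => .ite b p.compile q.compile
  | .loop c b p =>
      .seq (.set c (.const 0))
        (.while (.nle (.add (.var c) (.const 1)) (.var b))
          (.seq p.compile (.set c (.add (.var c) (.const 1)))))

/-- The memory after `k` rounds of a counting loop with counter `c` and body `f`. -/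
def iter (f : State → State) (c : ℕ) (s : State) : ℕ → State
  | 0 => s.setVar c 0
  | k + 1 => (f (iter f c s k)).setVar c (k + 1)

open Classical in
/-- The effect of a code on the memory. -/
noncomputable def run : Code → State → State
  | .skip => fun s => s
  | .set x e => fun s => s.setVar x (e.eval s)
  | .put a i j e => fun s => s.setArr a (i.eval s) (j.eval s) (e.eval s)
  | .rset x e => fun s => s.setRVar x (e.eval s)
  | .rput a i j e => fun s => s.setRArr a (i.eval s) (j.eval s) (e.eval s)
  | .seq p q => fun s => q.run (p.run s)
  | .ite b p q => fun s => if b.Holds s then p.run s else q.run s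
  | .loop c b p => fun s => iter p.run c s (s.var b)

/-- The natural-number variables written by a code. -/
def vars : Code → List ℕ
  | .set x _ => [x]
  | .seq p q => p.vars ++ q.vars
  | .ite _ p q => p.vars ++ q.vars
  | .loop c _ p => c :: p.vars
  | _ => []

/-- The natural-number arrays written by a code. -/
def arrs : Code → List ℕ
  | .put a _ _ _ => [a]
  | .seq p q => p.arrs ++ q.arrs
  | .ite _ p q => p.arrs ++ q.arrs
  | .loop _ _ p => p.arrs
  | _ => []

/-- The real variables written by a code. -/
def rvars : Code → List ℕ
  | .rset x _ => [x]
  | .seq p q => p.rvars ++ q.rvars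
  | .ite _ p q => p.rvars ++ q.rvars
  | .loop _ _ p => p.rvars
  | _ => []

/-- The real arrays written by a code. -/
def rarrs : Code → List ℕ
  | .rput a _ _ _ => [a]
  | .seq p q => p.rarrs ++ q.rarrs
  | .ite _ p q => p.rarrs ++ q.rarrs
  | .loop _ _ p => p.rarrs
  | _ => []

/-- The loops are bounded by the variables `0` and `1`, and no body changes its loop counter. -/
def wf : Code → Bool
  | .seq p q => p.wf && q.wf
  | .ite _ p q => p.wf && q.wf
  | .loop c b p => decide (b < 2) && decide (c ∉ p.vars) && p.wf
  | _ => true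

/-- A bound for the running time in terms of a bound for the variables `0` and `1`. -/
noncomputable def time : Code → Polynomial ℕ
  | .skip => 1
  | .set _ e => (e.cost + 1 : ℕ)
  | .put _ i j e => (i.cost + j.cost + e.cost + 1 : ℕ)
  | .rset _ e => (e.cost + 1 : ℕ)
  | .rput _ i j e => (i.cost + j.cost + e.cost + 1 : ℕ)
  | .seq p q => p.time + q.time
  | .ite b p q => (b.cost : ℕ) + p.time + q.time
  | .loop _ _ p => 7 + Polynomial.X * (9 + p.time)

/-- Two memories agree outside of what a code may write. -/
structure Frame (p : Code) (s s' : State) : Prop where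
  var : ∀ x, x ∉ p.vars → s'.var x = s.var x
  arr : ∀ a, a ∉ p.arrs → s'.arr a = s.arr a
  rvar : ∀ x, x ∉ p.rvars → s'.rvar x = s.rvar x
  rarr : ∀ a, a ∉ p.rarrs → s'.rarr a = s.rarr a

theorem frame_iter {p : Code} (hp : ∀ s, Frame p s (p.run s)) (c b : ℕ) (s : State) (k : ℕ) :
    Frame (.loop c b p) s (iter p.run c s k) := by
  induction k with
  | zero =>
    refine ⟨fun x hx => ?_, fun a _ => rfl, fun x _ => rfl, fun a _ => rfl⟩
    simp only [vars, List.mem_cons, not_or] at hx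
    simp [iter, State.setVar, hx.1]
  | succ k ih =>
    refine ⟨fun x hx => ?_, fun a ha => ?_, fun x hx => ?_, fun a ha => ?_⟩
    · have h1 := ih.var x hx
      simp only [vars, List.mem_cons, not_or] at hx
      simp only [iter, State.setVar, if_neg hx.1]
      rw [(hp _).var x hx.2, h1]
    · exact ((hp _).arr a ha).trans (ih.arr a ha)
    · exact ((hp _).rvar x hx).trans (ih.rvar x hx)
    · exact ((hp _).rarr a ha).trans (ih.rarr a ha)

/-- A code changes only what it writes. -/
theorem frame_run (p : Code) (s : State) : Frame p s (p.run s) := by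
  induction p generalizing s with
  | skip => exact ⟨fun _ _ => rfl, fun _ _ => rfl, fun _ _ => rfl, fun _ _ => rfl⟩
  | set x e =>
    refine ⟨fun y hy => ?_, fun _ _ => rfl, fun _ _ => rfl, fun _ _ => rfl⟩
    simp only [vars, List.mem_singleton] at hy
    simp [run, State.setVar, hy]
  | put a i j e =>
    refine ⟨fun _ _ => rfl, fun y hy => ?_, fun _ _ => rfl, fun _ _ => rfl⟩
    simp only [arrs, List.mem_singleton] at hy
    simp [run, State.setArr, hy]
  | rset x e =>
    refine ⟨fun _ _ => rfl, fun _ _ => rfl, fun y hy => ?_, fun _ _ => rfl⟩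
    simp only [rvars, List.mem_singleton] at hy
    simp [run, State.setRVar, hy]
  | rput a i j e =>
    refine ⟨fun _ _ => rfl, fun _ _ => rfl, fun _ _ => rfl, fun y hy => ?_⟩
    simp only [rarrs, List.mem_singleton] at hy
    simp [run, State.setRArr, hy]
  | seq p q hp hq =>
    refine ⟨fun x hx => ?_, fun x hx => ?_, fun x hx => ?_, fun x hx => ?_⟩
    · simp only [vars, List.mem_append, not_or] at hx
      exact ((hq _).var x hx.2).trans ((hp s).var x hx.1)
    · simp only [arrs, List.mem_append, not_or] at hx
      exact ((hq _).arr x hx.2).trans ((hp s).arr x hx.1)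
    · simp only [rvars, List.mem_append, not_or] at hx
      exact ((hq _).rvar x hx.2).trans ((hp s).rvar x hx.1)
    · simp only [rarrs, List.mem_append, not_or] at hx
      exact ((hq _).rarr x hx.2).trans ((hp s).rarr x hx.1)
  | ite b p q hp hq =>
    by_cases hb : b.Holds s
    · refine ⟨fun x hx => ?_, fun x hx => ?_, fun x hx => ?_, fun x hx => ?_⟩ <;>
        simp only [vars, arrs, rvars, rarrs, List.mem_append, not_or] at hx <;>
        simp only [run, if_pos hb]
      exacts [(hp s).var x hx.1, (hp s).arr x hx.1, (hp s).rvar x hx.1, (hp s).rarr x hx.1]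
    · refine ⟨fun x hx => ?_, fun x hx => ?_, fun x hx => ?_, fun x hx => ?_⟩ <;>
        simp only [vars, arrs, rvars, rarrs, List.mem_append, not_or] at hx <;>
        simp only [run, if_neg hb]
      exacts [(hq s).var x hx.2, (hq s).arr x hx.2, (hq s).rvar x hx.2, (hq s).rarr x hx.2]
  | loop c b p hp => exact frame_iter hp c b s _

theorem iter_var_counter (f : State → State) (c : ℕ) (s : State) (k : ℕ) :
    (iter f c s k).var c = k := by
  cases k <;> simp [iter, State.setVar]

/-- The invariant rule for counting loops. -/
theorem loop_induction {c b : ℕ} {p : Code} {s : State} (Inv : ℕ → State → Prop)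
    (h0 : Inv 0 (s.setVar c 0))
    (hstep : ∀ k < s.var b, ∀ s', Frame (.loop c b p) s s' → s'.var c = k → Inv k s' →
      Inv (k + 1) ((p.run s').setVar c (k + 1))) :
    Inv (s.var b) ((Code.loop c b p).run s) := by
  have key : ∀ k ≤ s.var b, Inv k (iter p.run c s k) := by
    intro k
    induction k with
    | zero => exact fun _ => h0
    | succ k ih =>
      intro hk
      exact hstep k hk _ (frame_iter (frame_run p) c b s k) (iter_var_counter _ _ _ _)
        (ih (Nat.le_of_succ_le hk))
  exact key _ le_rfl

/-- Induction on the number `j` of rounds still to come. A test costs 5 and an increment of the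
counter 4, so each round adds 9 to the cost of the body, and the last, failing test accounts for the
remaining 5. -/
theorem exec_while_iter {c b : ℕ} {p : Code} {s : State} {T : ℕ} (hcb : b ≠ c)
    (hb : b ∉ p.vars) (hc : c ∉ p.vars)
    (hp : ∀ k, ∃ t ≤ T, Exec p.compile (iter p.run c s k) t (iter p.run c s k |> p.run))
    (j k : ℕ) (hjk : j + k = s.var b) :
    ∃ t ≤ 5 + j * (9 + T),
      Exec (.while (.nle (.add (.var c) (.const 1)) (.var b))
          (.seq p.compile (.set c (.add (.var c) (.const 1)))))
        (iter p.run c s k) t (iter p.run c s (s.var b)) := by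
  have hvar : ∀ k, (iter p.run c s k).var b = s.var b := fun k =>
    (frame_iter (frame_run p) c b s k).var b (by simp [vars, hcb, hb])
  induction j generalizing k with
  | zero =>
    obtain rfl : k = s.var b := by omega
    refine ⟨5, by omega, Exec.whileFalse ?_⟩
    simp [Test.Holds, NExp.eval, iter_var_counter, hvar]
  | succ j ih =>
    obtain ⟨t, ht, hE⟩ := hp k
    obtain ⟨t', ht', hE'⟩ := ih (k + 1) (by omega)
    refine ⟨5 + (t + 4) + t', ?_, Exec.whileTrue ?_ (Exec.seq hE (Exec.set _ _ _)) ?_⟩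
    · have : (j + 1) * (9 + T) = j * (9 + T) + (9 + T) := by ring
      omega
    · simp only [Test.Holds, NExp.eval, iter_var_counter, hvar]
      omega
    · have : (p.run (iter p.run c s k)).var c = k := by
        rw [(frame_run p _).var c hc, iter_var_counter]
      simpa [iter, NExp.eval, this] using hE'

/-- A well-formed code halts within its time bound. -/
theorem exec_compile (p : Code) (hp : p.wf = true) (h0 : 0 ∉ p.vars) (h1 : 1 ∉ p.vars) {N : ℕ}
    (s : State) (hs : s.var 0 + s.var 1 ≤ N) :
    ∃ t ≤ p.time.eval N, Exec p.compile s t (p.run s) := by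
  induction p generalizing s with
  | skip => exact ⟨1, by simp [time], .skip _⟩
  | set x e => exact ⟨_, by simp [time], .set _ _ _⟩
  | put a i j e => exact ⟨_, by simp [time], .put _ _ _ _ _⟩
  | rset x e => exact ⟨_, by simp [time], .rset _ _ _⟩
  | rput a i j e => exact ⟨_, by simp [time], .rput _ _ _ _ _⟩
  | seq p q ihp ihq =>
    simp only [wf, Bool.and_eq_true, vars, List.mem_append, not_or] at hp h0 h1
    obtain ⟨t, ht, hE⟩ := ihp hp.1 h0.1 h1.1 s hs
    have hv := (frame_run p s).var
    obtain ⟨t', ht', hE'⟩ := ihq hp.2 h0.2 h1.2 (p.run s) (by rwa [hv 0 h0.1, hv 1 h1.1])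
    exact ⟨t + t', by simp only [time, Polynomial.eval_add]; omega, .seq hE hE'⟩
  | ite b p q ihp ihq =>
    simp only [wf, Bool.and_eq_true, vars, List.mem_append, not_or] at hp h0 h1
    by_cases hb : b.Holds s
    · obtain ⟨t, ht, hE⟩ := ihp hp.1 h0.1 h1.1 s hs
      refine ⟨b.cost + t, ?_, ?_⟩
      · simp only [time, Polynomial.eval_add, Polynomial.eval_natCast, Nat.cast_id]; omega
      · simp only [run, if_pos hb]; exact .iteTrue hb hE
    · obtain ⟨t, ht, hE⟩ := ihq hp.2 h0.2 h1.2 s hs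
      refine ⟨b.cost + t, ?_, ?_⟩
      · simp only [time, Polynomial.eval_add, Polynomial.eval_natCast, Nat.cast_id]; omega
      · simp only [run, if_neg hb]; exact .iteFalse hb hE
  | loop c b p ihp =>
    simp only [wf, Bool.and_eq_true, decide_eq_true_eq, vars, List.mem_cons, not_or] at hp h0 h1
    -- Variables `0` and `1` are never written, so the bound `N` on the number of rounds persists
    -- through all nested loops.
    have hbc : b ≠ c ∧ b ∉ p.vars ∧ s.var b ≤ N := by
      obtain rfl | rfl : b = 0 ∨ b = 1 := by omega
      exacts [⟨h0.1, h0.2, by omega⟩, ⟨h1.1, h1.2, by omega⟩]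
    have hbody : ∀ k, ∃ t ≤ p.time.eval N,
        Exec p.compile (iter p.run c s k) t (iter p.run c s k |> p.run) := by
      intro k
      have hv := (frame_iter (frame_run p) c b s k).var
      refine ihp hp.2 h0.2 h1.2 _ ?_
      rwa [hv 0 (by simp [vars, h0]), hv 1 (by simp [vars, h1])]
    obtain ⟨t, ht, hE⟩ := exec_while_iter hbc.1 hbc.2.1 hp.1.2 hbody (s.var b) 0 rfl
    refine ⟨2 + t, ?_, .seq (.set _ _ _) hE⟩
    have := Nat.mul_le_mul_right (9 + p.time.eval N) hbc.2.2
    simp only [time, Polynomial.eval_add, Polynomial.eval_mul, Polynomial.eval_X,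
      Polynomial.eval_ofNat]
    omega

end Code

end RealRAM

/-! ### Counting, and selecting one in `d` elements of each fibre. -/

open Classical in
/-- The number of `x < n` with the property `p`. -/
noncomputable def cnt (p : ℕ → Prop) (n : ℕ) : ℕ := ((Finset.range n).filter p).card

section Counting

theorem cnt_zero (p : ℕ → Prop) : cnt p 0 = 0 := by simp [cnt]

theorem cnt_succ_of_pos {p : ℕ → Prop} {n : ℕ} (h : p n) : cnt p (n + 1) = cnt p n + 1 := by
  simp [cnt, Finset.range_add_one, Finset.filter_insert, h]

theorem cnt_succ_of_neg {p : ℕ → Prop} {n : ℕ} (h : ¬ p n) : cnt p (n + 1) = cnt p n := by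
  simp [cnt, Finset.range_add_one, Finset.filter_insert, h]

theorem cnt_congr {p q : ℕ → Prop} {n : ℕ} (h : ∀ x < n, (p x ↔ q x)) : cnt p n = cnt q n := by
  unfold cnt
  congr 1
  ext x
  simp only [Finset.mem_filter, Finset.mem_range]
  exact and_congr_right fun hx => h x hx

theorem cnt_true {p : ℕ → Prop} {n : ℕ} (h : ∀ x < n, p x) : cnt p n = n := by
  unfold cnt
  classical
  rw [Finset.filter_true_of_mem (by simpa using h), Finset.card_range]

theorem cnt_eq_zero {p : ℕ → Prop} {n : ℕ} : cnt p n = 0 ↔ ∀ x < n, ¬ p x := by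
  simp [cnt, Finset.card_eq_zero, Finset.filter_eq_empty_iff]

theorem cnt_pos {p : ℕ → Prop} {n : ℕ} : 0 < cnt p n ↔ ∃ x < n, p x := by
  rw [Nat.pos_iff_ne_zero, ne_eq, cnt_eq_zero]; push Not; rfl

open Classical in
theorem cnt_mono (p : ℕ → Prop) {a b : ℕ} (h : a ≤ b) : cnt p a ≤ cnt p b :=
  Finset.card_le_card (Finset.filter_subset_filter _ (Finset.range_mono h))

open Classical in
theorem cnt_le (p : ℕ → Prop) (n : ℕ) : cnt p n ≤ n := by
  simpa [cnt] using Finset.card_filter_le (Finset.range n) p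

open Classical in
theorem cnt_le_cnt {p q : ℕ → Prop} {n : ℕ} (h : ∀ x, p x → q x) : cnt p n ≤ cnt q n :=
  Finset.card_le_card (Finset.monotone_filter_right _ fun x _ => h x)

theorem cnt_lt_cnt {p : ℕ → Prop} {a b : ℕ} (h : a < b) (ha : p a) : cnt p a < cnt p b := by
  have := cnt_mono p (show a + 1 ≤ b from h)
  rw [cnt_succ_of_pos ha] at this
  omega

/-- For `a` with `p a`, `cnt p a` is the rank of `a` among the elements of `p`. Ranks serve below as
the positions of chosen rows and columns in the factors. -/
theorem cnt_injOn {p : ℕ → Prop} {a b : ℕ} (ha : p a) (hb : p b) (h : cnt p a = cnt p b) :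
    a = b := by
  rcases lt_trichotomy a b with hl | hl | hl
  · have := cnt_lt_cnt hl ha; omega
  · exact hl
  · have := cnt_lt_cnt hl hb; omega

open Classical in
theorem cnt_add_cnt_not (p : ℕ → Prop) (n : ℕ) : cnt p n + cnt (fun x => ¬ p x) n = n := by
  have := Finset.card_filter_add_card_filter_not (s := Finset.range n) p
  rw [Finset.card_range] at this
  unfold cnt
  convert this

open Classical in
theorem cnt_eq_card_fin (p : ℕ → Prop) (n : ℕ) :
    cnt p n = (Finset.univ.filter fun x : Fin n => p x).card := by
  unfold cnt
  rw [Finset.card_filter, Finset.card_filter, Finset.sum_range]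

/-- Counting inside an enumerated set. -/
theorem cnt_cnt (p q : ℕ → Prop) (n : ℕ) :
    cnt q (cnt p n) = cnt (fun x => p x ∧ q (cnt p x)) n := by
  induction n with
  | zero => simp [cnt_zero]
  | succ n ih =>
    by_cases hp : p n
    · rw [cnt_succ_of_pos hp]
      by_cases hq : q (cnt p n)
      · rw [cnt_succ_of_pos hq, cnt_succ_of_pos (p := fun x => p x ∧ q (cnt p x)) ⟨hp, hq⟩, ih]
      · rw [cnt_succ_of_neg hq,
          cnt_succ_of_neg (p := fun x => p x ∧ q (cnt p x)) (fun h => hq h.2), ih]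
    · rw [cnt_succ_of_neg hp,
        cnt_succ_of_neg (p := fun x => p x ∧ q (cnt p x)) (fun h => hp h.1), ih]

open Classical in
theorem cnt_eq_sum_image {γ : Type*} (p : ℕ → Prop) (c : ℕ → γ) (n : ℕ) :
    cnt p n = ∑ u ∈ (Finset.range n).image c, cnt (fun x => c x = u ∧ p x) n := by
  unfold cnt
  rw [Finset.card_eq_sum_card_fiberwise (f := c) (t := (Finset.range n).image c)]
  · refine Finset.sum_congr rfl fun u _ => ?_
    rw [Finset.filter_filter]
    congr 1
    ext x
    simp only [Finset.mem_filter]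
    tauto
  · intro x hx
    simp only [Finset.coe_filter, Set.mem_ofPred_eq] at hx
    exact Finset.mem_coe.2 (Finset.mem_image_of_mem c hx.1)

/-- Every `d`-th element of each fibre of `c` is selected, beginning with the first. -/
def Selected {γ : Type*} (c : ℕ → γ) (d x : ℕ) : Prop := d ∣ cnt (fun y => c y = c x) x

/-- The elements of a fibre have ranks 0, 1, 2, … inside it, and those with rank divisible by `d`
are selected. This makes the size of the fibre divided by `d`, rounded up. -/
theorem cnt_selected_fibre {γ : Type*} (c : ℕ → γ) {d : ℕ} (hd : 0 < d) (u : γ) (n : ℕ) :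
    cnt (fun x => c x = u ∧ Selected c d x) n = (cnt (fun x => c x = u) n + (d - 1)) / d := by
  induction n with
  | zero => rw [cnt_zero, cnt_zero, Nat.div_eq_of_lt (by omega)]
  | succ n ih =>
    by_cases hu : c n = u
    · rw [cnt_succ_of_pos (p := fun x => c x = u) hu]
      by_cases hs : Selected c d n
      · rw [cnt_succ_of_pos (p := fun x => c x = u ∧ Selected c d x) ⟨hu, hs⟩, ih]
        unfold Selected at hs
        rw [hu] at hs
        obtain ⟨k, hk⟩ := hs
        rw [hk, show d * k + 1 + (d - 1) = d * (k + 1) by rw [mul_add]; omega,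
          Nat.mul_div_cancel_left _ hd, Nat.mul_add_div hd, Nat.div_eq_of_lt (a := d - 1) (by omega)]
      · rw [cnt_succ_of_neg (p := fun x => c x = u ∧ Selected c d x) (fun h => hs h.2), ih]
        unfold Selected at hs
        rw [hu] at hs
        rw [show cnt (fun x => c x = u) n + 1 + (d - 1) = cnt (fun x => c x = u) n + (d - 1) + 1 by
          omega, Nat.succ_div_of_not_dvd]
        rw [show cnt (fun x => c x = u) n + (d - 1) + 1 = cnt (fun x => c x = u) n + d by omega]
        simpa using hs
    · rw [cnt_succ_of_neg (p := fun x => c x = u) hu,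
        cnt_succ_of_neg (p := fun x => c x = u ∧ Selected c d x) (fun h => hu h.1), ih]

theorem le_mul_cnt_selected {γ : Type*} (c : ℕ → γ) {d : ℕ} (hd : 0 < d) (u : γ) (n : ℕ) :
    cnt (fun x => c x = u) n ≤ cnt (fun x => c x = u ∧ Selected c d x) n * d := by
  rw [cnt_selected_fibre c hd]
  have h1 := Nat.div_add_mod (cnt (fun x => c x = u) n + (d - 1)) d
  have h2 := Nat.mod_lt (cnt (fun x => c x = u) n + (d - 1)) hd
  rw [mul_comm]
  omega

theorem mul_cnt_selected_of_dvd {γ : Type*} (c : ℕ → γ) {d : ℕ} (hd : 0 < d) (u : γ) (n : ℕ)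
    (h : d ∣ cnt (fun x => c x = u) n) :
    cnt (fun x => c x = u ∧ Selected c d x) n * d = cnt (fun x => c x = u) n := by
  rw [cnt_selected_fibre c hd]
  obtain ⟨k, hk⟩ := h
  rw [hk, Nat.mul_add_div hd, Nat.div_eq_of_lt (a := d - 1) (by omega), add_zero, mul_comm]

theorem sum_cnt_fibre {γ : Type*} [DecidableEq γ] (c : ℕ → γ) (n : ℕ) :
    ∑ u ∈ (Finset.range n).image c, cnt (fun x => c x = u) n = n := by
  have h := cnt_eq_sum_image (fun _ => True) c n
  rw [cnt_true (fun _ _ => trivial)] at h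
  simp only [and_true] at h
  convert h.symm

/-- If every fibre has a size divisible by `d`, then one in `d` elements is selected. -/
theorem cnt_selected_mul {γ : Type*} (c : ℕ → γ) {d : ℕ} (hd : 0 < d) (n : ℕ)
    (h : ∀ x < n, d ∣ cnt (fun y => c y = c x) n) : cnt (Selected c d) n * d = n := by
  classical
  conv_rhs => rw [← sum_cnt_fibre c n]
  rw [cnt_eq_sum_image (Selected c d) c n, Finset.sum_mul]
  refine Finset.sum_congr (by congr) fun u hu => ?_
  obtain ⟨x, hx, rfl⟩ := Finset.mem_image.1 hu
  exact mul_cnt_selected_of_dvd c hd _ n (h x (Finset.mem_range.1 hx))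

/-- If one in `d` elements is selected, then this holds in every fibre. -/
theorem cnt_selected_fibre_mul {γ : Type*} (c : ℕ → γ) {d : ℕ} (hd : 0 < d) (n : ℕ)
    (h : cnt (Selected c d) n * d = n) (u : γ) :
    cnt (fun x => c x = u ∧ Selected c d x) n * d = cnt (fun x => c x = u) n := by
  classical
  by_cases hu : u ∈ (Finset.range n).image c
  · have h1 := sum_cnt_fibre c n
    rw [cnt_eq_sum_image (Selected c d) c n, Finset.sum_mul] at h
    -- Rounding up gives an inequality in each fibre. The totals agree, so no fibre can be strict.
    have h2 := (Finset.sum_eq_sum_iff_of_le (s := (Finset.range n).image c)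
      (fun v _ => le_mul_cnt_selected c hd v n)).1 (by rw [h1]; convert h.symm)
    exact (h2 u hu).symm
  · have h0 : cnt (fun x => c x = u) n = 0 :=
      cnt_eq_zero.2 fun x hx hxu => hu (Finset.mem_image.2 ⟨x, Finset.mem_range.2 hx, hxu⟩)
    rw [h0, cnt_eq_zero.2 fun x hx hxu => cnt_eq_zero.1 h0 x hx hxu.1, zero_mul]

end Counting

/-! ### Independence of sets of rows. -/

section Independence

variable (M : ℕ → ℕ → ℝ) (n : ℕ)

/-- The number of the first `n` columns of `M` which agree with `z` in the rows `A`. -/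
noncomputable def colCount (A : Finset ℕ) (z : ℕ → ℝ) : ℕ := cnt (fun x => ∀ i ∈ A, M i x = z i) n

/-- For a random column among the first `n` columns of `M`, the parts in the rows `A` and in the
rows `B` are independent. -/
def RowIndep (A B : Finset ℕ) : Prop :=
  ∀ z, colCount M n (A ∪ B) z * n = colCount M n A z * colCount M n B z

/-- The part of column `x` in the rows `A`. -/
noncomputable def colPart (A : Finset ℕ) (x : ℕ) : ℕ → ℝ := fun i => if i ∈ A then M i x else 0

variable {M n} {A B C T Z : Finset ℕ} {i : ℕ} {z w : ℕ → ℝ}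

theorem colPart_eq_iff {x y : ℕ} : colPart M A x = colPart M A y ↔ ∀ i ∈ A, M i x = M i y := by
  unfold colPart
  constructor
  · intro h i hi
    simpa [hi] using congrFun h i
  · intro h
    funext i
    by_cases hi : i ∈ A <;> simp [hi, h]

theorem colCount_congr (h : ∀ i ∈ A, z i = w i) : colCount M n A z = colCount M n A w :=
  cnt_congr fun x _ => forall₂_congr fun i hi => by rw [h i hi]

theorem colCount_empty : colCount M n ∅ z = n := cnt_true (by simp)

theorem RowIndep.symm (h : RowIndep M n A B) : RowIndep M n B A := fun z => by
  rw [Finset.union_comm, h z, mul_comm]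

theorem rowIndep_empty : RowIndep M n A ∅ := fun z => by
  rw [Finset.union_empty, colCount_empty]

-- Marginalization: the columns are sorted by their entry in row `i`.
open Classical in
theorem colCount_eq_sum_insert (hi : i ∉ A) :
    colCount M n A z =
      ∑ t ∈ (Finset.range n).image (M i), colCount M n (insert i A) (Function.update z i t) := by
  unfold colCount
  rw [cnt_eq_sum_image _ (M i)]
  refine Finset.sum_congr rfl fun t _ => cnt_congr fun x _ => ?_
  rw [Finset.forall_mem_insert, Function.update_self]
  refine and_congr_right fun _ => forall₂_congr fun j hj => ?_
  rw [Function.update_of_ne (ne_of_mem_of_not_mem hj hi)]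

/-- Sum the product formula over the entry in row `i`; the factor for `A` does not involve that row.
-/
theorem RowIndep.of_insert (h : RowIndep M n A (insert i B)) (hA : i ∉ A) (hB : i ∉ B) :
    RowIndep M n A B := by
  classical
  intro z
  rw [colCount_eq_sum_insert (i := i) (A := A ∪ B) (by simp [hA, hB]),
    colCount_eq_sum_insert (i := i) (A := B) hB, Finset.sum_mul, Finset.mul_sum]
  refine Finset.sum_congr rfl fun t _ => ?_
  rw [← Finset.union_insert, h, colCount_congr (A := A) (w := z)]
  intro j hj
  rw [Function.update_of_ne (ne_of_mem_of_not_mem hj hA)]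

/-- The decomposition rule of conditional independence: superfluous rows are removed one at a time.
-/
theorem RowIndep.mono_right (h : RowIndep M n A B) (hAB : Disjoint A B) (hC : C ⊆ B) :
    RowIndep M n A C := by
  classical
  obtain ⟨D, rfl⟩ : ∃ D, B = C ∪ D := ⟨B, (Finset.union_eq_right.2 hC).symm⟩
  clear hC
  induction D using Finset.induction_on with
  | empty => simpa using h
  | insert i D _ ih =>
    have hd : Disjoint A (C ∪ D) :=
      hAB.mono_right (Finset.union_subset_union le_rfl (Finset.subset_insert _ _))
    by_cases hi : i ∈ C ∪ D
    · refine ih ?_ hd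
      rwa [Finset.union_insert, Finset.insert_eq_of_mem hi] at h
    · refine ih (RowIndep.of_insert (i := i) ?_ ?_ hi) hd
      · rwa [Finset.union_insert] at h
      · exact fun hA => Finset.disjoint_left.1 hAB hA (by simp)

theorem RowIndep.mono (h : RowIndep M n A B) (hAB : Disjoint A B) (hC : C ⊆ A) (hT : T ⊆ B) :
    RowIndep M n C T :=
  ((h.mono_right hAB hT).symm.mono_right (hAB.mono_right hT).symm hC).symm

/-- The contraction rule: P(A,B,C) = P(A,B) P(C) = P(A) P(B) P(C) = P(A) P(B,C). In terms of counts
a factor `n` has to be cancelled. -/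
theorem RowIndep.contract (hn : 0 < n) (h₁ : RowIndep M n A B) (h₂ : RowIndep M n (A ∪ B) C)
    (hd : Disjoint (A ∪ B) C) : RowIndep M n A (B ∪ C) := by
  intro z
  have h₃ := h₂.mono hd Finset.subset_union_right (Finset.Subset.refl C)
  have e₁ := h₁ z
  have e₂ := h₂ z
  have e₃ := h₃ z
  rw [← Finset.union_assoc]
  refine Nat.eq_of_mul_eq_mul_right hn ?_
  rw [e₂, mul_right_comm, e₁, mul_assoc, mul_assoc, e₃]

/-- If `Z` splits off and `A ⊆ Z` becomes dependent on `T` when `r` is added to `T`, then `r`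
belongs to `Z`. -/
theorem RowIndep.mem_of_not_insert {R : Finset ℕ} {r : ℕ} (hn : 0 < n) (hZ : RowIndep M n Z (R \ Z))
    (hAZ : A ⊆ Z) (hTR : T ⊆ R) (hrR : r ∈ R) (hAT : Disjoint A T) (h : RowIndep M n A T)
    (hr : ¬ RowIndep M n A (insert r T)) : r ∈ Z := by
  by_contra hrZ
  apply hr
  -- If `r` were outside `Z`, the part of `insert r T` inside `Z` would be that of `T`. `A` is
  -- independent of this part by decomposition, and together they are independent of the part
  -- outside `Z`, so contraction contradicts `hr`.
  have e : insert r T = (T ∩ Z) ∪ (insert r T \ Z) := by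
    ext j
    simp only [Finset.mem_insert, Finset.mem_union, Finset.mem_inter, Finset.mem_sdiff]
    by_cases hj : j ∈ Z
    · have : j ≠ r := fun e => hrZ (e ▸ hj)
      simp [hj, this]
    · simp [hj]
  have hd : Disjoint Z (R \ Z) := Finset.disjoint_sdiff
  have s₁ : A ∪ T ∩ Z ⊆ Z := Finset.union_subset hAZ Finset.inter_subset_right
  have s₂ : insert r T \ Z ⊆ R \ Z :=
    Finset.sdiff_subset_sdiff (Finset.insert_subset hrR hTR) le_rfl
  rw [e]
  exact (h.mono_right hAT Finset.inter_subset_left).contract hn (hZ.mono hd s₁ s₂)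
    (hd.mono s₁ s₂)

theorem colCount_union_le_left : colCount M n (A ∪ B) z ≤ colCount M n A z :=
  cnt_le_cnt fun _ h i hi => h i (Finset.mem_union_left _ hi)

/-- Independence has to be checked for the values that occur only. -/
theorem rowIndep_iff (hd : Disjoint A B) :
    RowIndep M n A B ↔ ∀ a < n, ∀ b < n,
      cnt (fun x => (∀ i ∈ A, M i x = M i a) ∧ ∀ i ∈ B, M i x = M i b) n * n =
        cnt (fun x => ∀ i ∈ A, M i x = M i a) n * cnt (fun x => ∀ i ∈ B, M i x = M i b) n := by
  classical
  have key : ∀ (a b : ℕ) (z : ℕ → ℝ), (∀ i ∈ A, M i a = z i) → (∀ i ∈ B, M i b = z i) →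
      cnt (fun x => (∀ i ∈ A, M i x = M i a) ∧ ∀ i ∈ B, M i x = M i b) n =
          colCount M n (A ∪ B) z ∧
        cnt (fun x => ∀ i ∈ A, M i x = M i a) n = colCount M n A z ∧
        cnt (fun x => ∀ i ∈ B, M i x = M i b) n = colCount M n B z := by
    intro a b z ha hb
    refine ⟨cnt_congr fun x _ => ?_, colCount_congr ha, colCount_congr hb⟩
    rw [Finset.forall_mem_union]
    exact and_congr (forall₂_congr fun i hi => by rw [ha i hi])
      (forall₂_congr fun i hi => by rw [hb i hi])
  constructor
  · intro h a ha b hb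
    obtain ⟨e₁, e₂, e₃⟩ := key a b (fun i => if i ∈ A then M i a else M i b)
      (fun i hi => by simp [hi])
      (fun i hi => by simp [Finset.disjoint_right.1 hd hi])
    rw [e₁, e₂, e₃]
    exact h _
  · intro h z
    -- If no column matches `z` on `A`, or none on `B`, both sides vanish. Otherwise matching
    -- columns represent `z`.
    rcases Nat.eq_zero_or_pos (colCount M n A z) with h0 | hA
    · have := colCount_union_le_left (M := M) (n := n) (A := A) (B := B) (z := z)
      rw [h0] at this ⊢
      rw [Nat.le_zero.1 this, zero_mul, zero_mul]
    rcases Nat.eq_zero_or_pos (colCount M n B z) with h0 | hB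
    · have := colCount_union_le_left (M := M) (n := n) (A := B) (B := A) (z := z)
      rw [Finset.union_comm, h0] at this
      rw [h0, Nat.le_zero.1 this, zero_mul, mul_zero]
    obtain ⟨a, ha, haz⟩ := cnt_pos.1 hA
    obtain ⟨b, hb, hbz⟩ := cnt_pos.1 hB
    obtain ⟨e₁, e₂, e₃⟩ := key a b z haz hbz
    rw [← e₁, ← e₂, ← e₃]
    exact h a ha b hb

theorem cnt_colPart (x : ℕ) :
    cnt (fun y => colPart M A y = colPart M A x) n = cnt (fun y => ∀ i ∈ A, M i y = M i x) n :=
  cnt_congr fun _ _ => colPart_eq_iff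

/-- The multiplicities of independent parts allow a factorization of the number of columns. -/
theorem RowIndep.exists_dvd (hn : 0 < n) (h : RowIndep M n A B) (hd : Disjoint A B) :
    ∃ d, 0 < d ∧ cnt (Selected (colPart M A) d) n * d = n ∧
      cnt (Selected (colPart M B) (cnt (Selected (colPart M A) d) n)) n = d := by
  set f : ℕ → ℕ := fun x => cnt (fun y => colPart M A y = colPart M A x) n with hf
  set g : ℕ → ℕ := fun x => cnt (fun y => colPart M B y = colPart M B x) n with hg
  have hfg : ∀ x < n, ∀ y < n, n ∣ f x * g y := by
    intro x hx y hy
    rw [hf, hg]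
    simp only [cnt_colPart]
    rw [← (rowIndep_iff hd).1 h x hx y hy]
    exact Dvd.intro_left _ rfl
  -- The gcd is the choice for which divisibility of all `f x * g y` by `n` passes to `d * g y`, so
  -- that the cofactor `e` of `d` in `n` divides every `g y`.
  set d := (Finset.range n).gcd f with hdd
  have hdf : ∀ x < n, d ∣ f x := fun x hx => Finset.gcd_dvd (Finset.mem_range.2 hx)
  have hd0 : 0 < d := by
    refine Nat.pos_of_ne_zero fun h0 => ?_
    have := hdf 0 hn
    rw [h0, zero_dvd_iff] at this
    exact cnt_eq_zero.1 this 0 hn rfl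
  have he := cnt_selected_mul (colPart M A) hd0 n hdf
  refine ⟨d, hd0, he, ?_⟩
  set e := cnt (Selected (colPart M A) d) n
  have he0 : 0 < e := Nat.pos_of_ne_zero fun h0 => by rw [h0, zero_mul] at he; omega
  have hng : ∀ y < n, n ∣ d * g y := by
    intro y hy
    have : (Finset.range n).gcd (fun x => f x * g y) = d * g y := by
      rw [Finset.gcd_mul_right]; simp [hdd]
    rw [← this]
    exact Finset.dvd_gcd fun x hx => hfg x (Finset.mem_range.1 hx) y hy
  have heg : ∀ y < n, e ∣ g y := fun y hy => by
    have := hng y hy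
    rw [← he, mul_comm e d] at this
    exact Nat.dvd_of_mul_dvd_mul_left hd0 this
  have h2 := cnt_selected_mul (colPart M B) he0 n heg
  refine Nat.eq_of_mul_eq_mul_right he0 ?_
  rw [h2, ← he, mul_comm]

end Independence

/-! ### 1-products and independent splittings of the rows. -/

section Isomorphism

open Classical in
/-- Two finite families in which every value occurs equally often agree up to a bijection. -/
theorem exists_equiv_of_card_fibre {α β γ : Type*} [Fintype α] [Fintype β] (c : α → γ) (c' : β → γ)
    (h : ∀ z, (Finset.univ.filter fun a => c a = z).card =
      (Finset.univ.filter fun b => c' b = z).card) :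
    ∃ f : α ≃ β, ∀ a, c a = c' (f a) := by
  have e : ∀ z, Nonempty ({a // c a = z} ≃ {b // c' b = z}) := fun z => by
    refine Fintype.card_eq.1 ?_
    rw [Fintype.card_subtype, Fintype.card_subtype]
    exact h z
  exact ⟨Equiv.ofFiberEquiv fun z => (e z).some, fun a => (Equiv.ofFiberEquiv_map _ a).symm⟩

open Classical in
/-- Counting pairs, through the indexing of the columns of a 1-product. -/
theorem card_divNat_modNat {a b : ℕ} (p : Fin a → Prop) (q : Fin b → Prop) :
    (Finset.univ.filter fun j : Fin (a * b) => p j.divNat ∧ q j.modNat).card =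
      (Finset.univ.filter p).card * (Finset.univ.filter q).card := by
  rw [← Finset.card_product]
  refine Finset.card_equiv finProdFinEquiv.symm fun j => ?_
  simp [finProdFinEquiv]

/-- The positions of the rows when the rows in `A` are moved to the top. -/
theorem exists_row_equiv {m : ℕ} (p q : ℕ → Prop) (hpq : ∀ i < m, (q i ↔ ¬ p i)) :
    ∃ e : Fin m ≃ Fin (cnt p m + cnt q m),
      (∀ (i : Fin m) (hi : p i), e i = Fin.castAdd _ ⟨cnt p i, cnt_lt_cnt i.2 hi⟩) ∧
      (∀ (i : Fin m) (hi : q i), e i = Fin.natAdd _ ⟨cnt q i, cnt_lt_cnt i.2 hi⟩) := by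
  classical
  have hm : cnt p m + cnt q m = m := by
    rw [cnt_congr hpq]; exact cnt_add_cnt_not p m
  let e : Fin m → Fin (cnt p m + cnt q m) := fun i =>
    if hi : p i then Fin.castAdd _ ⟨cnt p i, cnt_lt_cnt i.2 hi⟩
    else Fin.natAdd _ ⟨cnt q i, cnt_lt_cnt i.2 ((hpq i i.2).2 hi)⟩
  have h1 : ∀ (i : Fin m) (hi : p i), e i = Fin.castAdd _ ⟨cnt p i, cnt_lt_cnt i.2 hi⟩ := fun i hi =>
    dif_pos hi
  have h2 : ∀ (i : Fin m) (hi : q i), e i = Fin.natAdd _ ⟨cnt q i, cnt_lt_cnt i.2 hi⟩ := fun i hi =>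
    dif_neg ((hpq i i.2).1 hi)
  have hinj : Function.Injective e := by
    intro i j hij
    by_cases hi : p i <;> by_cases hj : p j
    · rw [h1 i hi, h1 j hj] at hij
      exact Fin.ext (cnt_injOn hi hj (by simpa [Fin.ext_iff] using hij))
    · rw [h1 i hi, h2 j ((hpq j j.2).2 hj)] at hij
      have := cnt_lt_cnt i.2 hi
      simp [Fin.ext_iff] at hij
      omega
    · rw [h1 j hj, h2 i ((hpq i i.2).2 hi)] at hij
      have := cnt_lt_cnt j.2 hj
      simp [Fin.ext_iff] at hij
      omega
    · rw [h2 i ((hpq i i.2).2 hi), h2 j ((hpq j j.2).2 hj)] at hij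
      exact Fin.ext (cnt_injOn ((hpq i i.2).2 hi) ((hpq j j.2).2 hj)
        (by simpa [Fin.ext_iff] using hij))
  have hbij : Function.Bijective e :=
    (Fintype.bijective_iff_injective_and_card e).2 ⟨hinj, by simp [hm]⟩
  exact ⟨Equiv.ofBijective e hbij, h1, h2⟩

theorem oneProd_castAdd {m₁ n₁ m₂ n₂ : ℕ} (S₁ : Matrix (Fin m₁) (Fin n₁) ℝ)
    (S₂ : Matrix (Fin m₂) (Fin n₂) ℝ) (i : Fin m₁) (j : Fin (n₁ * n₂)) :
    oneProd S₁ S₂ (Fin.castAdd _ i) j = S₁ i j.divNat := by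
  simp [oneProd]

theorem oneProd_natAdd {m₁ n₁ m₂ n₂ : ℕ} (S₁ : Matrix (Fin m₁) (Fin n₁) ℝ)
    (S₂ : Matrix (Fin m₂) (Fin n₂) ℝ) (i : Fin m₂) (j : Fin (n₁ * n₂)) :
    oneProd S₁ S₂ (Fin.natAdd _ i) j = S₂ i j.modNat := by
  simp [oneProd]

/-- The multiplicity of a column in the matrix of the selected columns. -/
theorem cnt_selected_columns {M F : ℕ → ℕ → ℝ} {n d : ℕ} {A : Finset ℕ} (hd : 0 < d)
    (hn : cnt (Selected (colPart M A) d) n * d = n)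
    (hF : ∀ x < n, Selected (colPart M A) d x → ∀ i ∈ A,
      F (cnt (· ∈ A) i) (cnt (Selected (colPart M A) d) x) = M i x) (z : ℕ → ℝ) :
    cnt (fun k => ∀ i ∈ A, F (cnt (· ∈ A) i) k = z i) (cnt (Selected (colPart M A) d) n) * d =
      colCount M n A z := by
  have h1 : ∀ x, colPart M A x = (fun i => if i ∈ A then z i else 0) ↔ ∀ i ∈ A, M i x = z i := by
    intro x
    constructor
    · intro h i hi
      simpa [colPart, hi] using congrFun h i
    · intro h
      funext i
      by_cases hi : i ∈ A <;> simp [colPart, hi, h]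
  have h2 := cnt_selected_fibre_mul (colPart M A) hd n hn (fun i => if i ∈ A then z i else 0)
  rw [cnt_cnt]
  unfold colCount
  simp only [h1] at h2
  rw [← h2]
  congr 1
  refine cnt_congr fun x hx => ?_
  rw [and_comm]
  refine and_congr_left fun hs => forall₂_congr fun i hi => ?_
  rw [hF x hx hs i hi]

/-- The matrices of the selected columns form a factorization. -/
theorem matIso_of_selected {m n : ℕ} {S : Matrix (Fin m) (Fin n) ℝ} {M F₁ F₂ : ℕ → ℕ → ℝ}
    {A B : Finset ℕ} {c₁ c₂ d m₁ m₂ : ℕ} (hM : ∀ (i : Fin m) (j : Fin n), M i j = S i j)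
    (hA : A ⊆ Finset.range m) (hB : B = Finset.range m \ A) (hn : 0 < n)
    (hind : RowIndep M n A B) (hd : 0 < d)
    (hc₁ : c₁ = cnt (Selected (colPart M A) d) n) (hc₂ : c₂ = cnt (Selected (colPart M B) c₁) n)
    (hm₁ : m₁ = cnt (· ∈ A) m) (hm₂ : m₂ = cnt (· ∈ B) m)
    (h₁ : c₁ * d = n) (h₂ : c₂ = d)
    (hF₁ : ∀ x < n, Selected (colPart M A) d x → ∀ i ∈ A,
      F₁ (cnt (· ∈ A) i) (cnt (Selected (colPart M A) d) x) = M i x)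
    (hF₂ : ∀ x < n, Selected (colPart M B) c₁ x → ∀ i ∈ B,
      F₂ (cnt (· ∈ B) i) (cnt (Selected (colPart M B) c₁) x) = M i x) :
    MatIso S (oneProd (Matrix.of fun (i : Fin m₁) (j : Fin c₁) => F₁ i j)
      (Matrix.of fun (i : Fin m₂) (j : Fin c₂) => F₂ i j)) := by
  classical
  have hpq : ∀ i < m, (i ∈ B ↔ ¬ i ∈ A) := fun i hi => by simp [hB, hi]
  have hc₁0 : 0 < c₁ := Nat.pos_of_ne_zero fun h0 => by rw [h0, zero_mul] at h₁; omega
  obtain ⟨e, he₁, he₂⟩ := exists_row_equiv (· ∈ A) (· ∈ B) hpq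
  subst hm₁ hm₂
  set P := oneProd (Matrix.of fun (i : Fin (cnt (· ∈ A) m)) (j : Fin c₁) => F₁ i j)
      (Matrix.of fun (i : Fin (cnt (· ∈ B) m)) (j : Fin c₂) => F₂ i j) with hP
  have hPA : ∀ (i : Fin m) (j), (i : ℕ) ∈ A → P (e i) j = F₁ (cnt (· ∈ A) i) j.divNat :=
    fun i j hi => by rw [he₁ i hi, hP, oneProd_castAdd]; rfl
  have hPB : ∀ (i : Fin m) (j), (i : ℕ) ∈ B → P (e i) j = F₂ (cnt (· ∈ B) i) j.modNat :=
    fun i j hi => by rw [he₂ i hi, hP, oneProd_natAdd]; rfl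
  have hlt : ∀ i, i ∈ A ∨ i ∈ B → i < m := by
    rintro i (hi | hi)
    · exact Finset.mem_range.1 (hA hi)
    · exact Finset.mem_range.1 (Finset.mem_sdiff.1 (hB ▸ hi)).1
  -- With the rows matched, a column bijection exists once each vector `z` occurs equally often on
  -- both sides. In the 1-product its multiplicity is the product of those of its two parts.
  obtain ⟨f, hf⟩ := exists_equiv_of_card_fibre (fun x (i : Fin m) => S i x)
    (fun j (i : Fin m) => P (e i) j) fun z => by
      let w : ℕ → ℝ := fun i => if h : i < m then z ⟨i, h⟩ else 0
      have hw : ∀ i : Fin m, w i = z i := fun i => dif_pos i.2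
      have hl : (Finset.univ.filter fun x => (fun i => S i x) = z).card =
          colCount M n (A ∪ B) w := by
        rw [colCount, cnt_eq_card_fin]
        congr 1
        ext x
        simp only [Finset.mem_filter, Finset.mem_univ, true_and, funext_iff]
        constructor
        · intro h i hi
          have hi := hlt i (Finset.mem_union.1 hi)
          have h1 := h ⟨i, hi⟩
          have h2 := hM ⟨i, hi⟩ x
          have h3 := hw ⟨i, hi⟩
          simp only at h2 h3
          rw [h2, h3, h1]
        · intro h i
          rw [← hM, ← hw]
          refine h i (Finset.mem_union.2 ?_)
          by_cases hi : (i : ℕ) ∈ A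
          · exact .inl hi
          · exact .inr ((hpq i i.2).2 hi)
      have hr : (Finset.univ.filter fun j => (fun i => P (e i) j) = z).card =
          cnt (fun k => ∀ i ∈ A, F₁ (cnt (· ∈ A) i) k = w i) c₁ *
            cnt (fun l => ∀ i ∈ B, F₂ (cnt (· ∈ B) i) l = w i) c₂ := by
        rw [cnt_eq_card_fin _ c₁, cnt_eq_card_fin _ c₂, ← card_divNat_modNat]
        congr 1
        ext j
        simp only [Finset.mem_filter, Finset.mem_univ, true_and, funext_iff]
        constructor
        · intro h
          refine ⟨fun i hi => ?_, fun i hi => ?_⟩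
          · have h1 := h ⟨i, hlt i (.inl hi)⟩
            rw [← hw, hPA _ _ hi] at h1
            exact h1
          · have h1 := h ⟨i, hlt i (.inr hi)⟩
            rw [← hw, hPB _ _ hi] at h1
            exact h1
        · intro h i
          by_cases hi : (i : ℕ) ∈ A
          · rw [hPA _ _ hi, h.1 i hi, hw]
          · have hi := (hpq i i.2).2 hi
            rw [hPB _ _ hi, h.2 i hi, hw]
      have k₁ := cnt_selected_columns hd (hc₁ ▸ h₁) hF₁ w
      have k₂ := cnt_selected_columns hc₁0 (by rw [← hc₂, h₂, mul_comm, h₁]) hF₂ w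
      rw [← hc₁] at k₁
      rw [← hc₂] at k₂
      have k₃ := hind w
      rw [← k₁, ← k₂] at k₃
      -- By `k₁` and `k₂`, independence says that the left side times `n` is the right side times `d
      -- * c₁`, which is `n`.
      have hmid : colCount M n (A ∪ B) w =
          cnt (fun k => ∀ i ∈ A, F₁ (cnt (· ∈ A) i) k = w i) c₁ *
            cnt (fun l => ∀ i ∈ B, F₂ (cnt (· ∈ B) i) l = w i) c₂ := by
        refine Nat.eq_of_mul_eq_mul_right hn ?_
        rw [k₃, ← h₁]
        ring
      exact Eq.trans (by convert hl) (hmid.trans (Eq.trans hr.symm (by congr)))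
  exact ⟨e, f, fun i j => congrFun (hf j) i⟩

open Classical in
/-- A 1-product has a nontrivial splitting of the rows into independent parts. -/
theorem IsOneProduct.exists_rowIndep {m n : ℕ} {S : Matrix (Fin m) (Fin n) ℝ} (hS : IsOneProduct S)
    {M : ℕ → ℕ → ℝ} (hM : ∀ (i : Fin m) (j : Fin n), M i j = S i j) :
    0 < n ∧ ∃ Z ⊆ Finset.range m, RowIndep M n Z (Finset.range m \ Z) ∧ 0 ∈ Z ∧
      ∃ i < m, i ∉ Z := by
  obtain ⟨m₁, n₁, m₂, n₂, S₁, S₂, hm₁, hn₁, hm₂, hn₂, e, f, hef⟩ := hS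
  have hnn : n = n₁ * n₂ := by simpa using Fintype.card_congr f
  have hmm : m = m₁ + m₂ := by simpa using Fintype.card_congr e
  refine ⟨hnn ▸ Nat.mul_pos hn₁ hn₂, ?_⟩
  let p : ℕ → Prop := fun i => ∃ h : i < m, (e ⟨i, h⟩ : ℕ) < m₁
  have hi₁ : ∀ i : Fin m, p i → ∃ k, e i = Fin.castAdd _ k := fun i ⟨_, hi⟩ =>
    ⟨⟨e i, hi⟩, rfl⟩
  have hi₂ : ∀ i : Fin m, ¬ p i → ∃ k, e i = Fin.natAdd _ k := fun i hi => by
    have h1 : ¬ ((e i : ℕ) < m₁) := fun h => hi ⟨i.2, h⟩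
    exact ⟨⟨e i - m₁, by omega⟩, Fin.ext (by simp; omega)⟩
  set A := (Finset.range m).filter p with hA
  have hsub : A ⊆ Finset.range m := Finset.filter_subset _ _
  have hind : RowIndep M n A (Finset.range m \ A) := by
    intro z
    -- A condition on the top rows concerns only the first component of a column index, one on the
    -- bottom rows only the second. Hence the counts multiply.
    let q₁ : Fin n₁ → Prop := fun k => ∀ (i : Fin m) (k' : Fin m₁), e i = Fin.castAdd _ k' →
      S₁ k' k = z i
    let q₂ : Fin n₂ → Prop := fun k => ∀ (i : Fin m) (k' : Fin m₂), e i = Fin.natAdd _ k' →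
      S₂ k' k = z i
    have h₁ : ∀ x : Fin n, (∀ i ∈ A, M i x = z i) ↔ q₁ (f x).divNat := by
      intro x
      constructor
      · intro h i k' hk
        have hi : (i : ℕ) ∈ A :=
          Finset.mem_filter.2 ⟨Finset.mem_range.2 i.2, i.2, by rw [hk]; exact k'.2⟩
        rw [← h i hi, hM, hef, hk, oneProd_castAdd]
      · intro h i hi
        obtain ⟨hi, hpi⟩ := Finset.mem_filter.1 hi
        obtain ⟨k', hk⟩ := hi₁ ⟨i, Finset.mem_range.1 hi⟩ hpi
        rw [← h _ k' hk, ← oneProd_castAdd S₁ S₂, ← hk, ← hef, ← hM]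
    have h₂ : ∀ x : Fin n, (∀ i ∈ Finset.range m \ A, M i x = z i) ↔ q₂ (f x).modNat := by
      intro x
      constructor
      · intro h i k' hk
        have hi : (i : ℕ) ∈ Finset.range m \ A := by
          refine Finset.mem_sdiff.2 ⟨Finset.mem_range.2 i.2, fun hi => ?_⟩
          obtain ⟨_, hi⟩ := (Finset.mem_filter.1 hi).2
          rw [Fin.eta, hk] at hi
          simp at hi
        rw [← h i hi, hM, hef, hk, oneProd_natAdd]
      · intro h i hi
        obtain ⟨hi, hpi⟩ := Finset.mem_sdiff.1 hi
        obtain ⟨k', hk⟩ := hi₂ ⟨i, Finset.mem_range.1 hi⟩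
          fun h => hpi (Finset.mem_filter.2 ⟨hi, h⟩)
        rw [← h _ k' hk, ← oneProd_natAdd S₁ S₂, ← hk, ← hef, ← hM]
    have key : ∀ (C : Finset ℕ) (p : Fin n₁ → Prop) (q : Fin n₂ → Prop),
        (∀ x : Fin n, (∀ i ∈ C, M i x = z i) ↔ p (f x).divNat ∧ q (f x).modNat) →
        colCount M n C z = (Finset.univ.filter p).card * (Finset.univ.filter q).card := by
      intro C p q h
      rw [colCount, cnt_eq_card_fin, ← card_divNat_modNat]
      refine Finset.card_equiv f fun x => ?_
      simp only [Finset.mem_filter, Finset.mem_univ, true_and]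
      exact h x
    rw [key _ q₁ q₂ fun x => by rw [Finset.forall_mem_union, h₁, h₂],
      key A q₁ (fun _ => True) fun x => by rw [h₁, and_true],
      key _ (fun _ => True) q₂ fun x => by rw [h₂, true_and]]
    simp only [Finset.filter_true, Finset.card_univ, Fintype.card_fin]
    rw [hnn]
    ring
  have hk₁ : ∃ i < m, i ∈ A := by
    refine ⟨e.symm ⟨0, by omega⟩, (e.symm _).2, ?_⟩
    simp [hA, p, hm₁]
  have hk₂ : ∃ i < m, i ∉ A := by
    refine ⟨e.symm ⟨m₁, by omega⟩, (e.symm _).2, ?_⟩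
    simp [hA, p]
  -- Independence is symmetric, so the part containing row 0 may serve as `Z`.
  by_cases h0 : 0 ∈ A
  · exact ⟨A, hsub, hind, h0, hk₂⟩
  · obtain ⟨i, hi, hiA⟩ := hk₁
    refine ⟨Finset.range m \ A, Finset.sdiff_subset, ?_, ?_, i, hi, ?_⟩
    · rw [Finset.sdiff_sdiff_eq_self hsub]
      exact hind.symm
    · simp [h0]; omega
    · simp [hiA]

end Isomorphism

/-! ### Comparing columns and testing independence by program. -/

namespace RealRAM

open Code

section Simp

variable (s : State) (x y v a b i j k l : ℕ) (r : ℝ)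

@[simp] theorem State.setVar_var : (s.setVar x v).var y = if y = x then v else s.var y := rfl
@[simp] theorem State.setVar_arr : (s.setVar x v).arr = s.arr := rfl
@[simp] theorem State.setVar_rvar : (s.setVar x v).rvar = s.rvar := rfl
@[simp] theorem State.setVar_rarr : (s.setVar x v).rarr = s.rarr := rfl
@[simp] theorem State.setArr_arr : (s.setArr a i j v).arr b k l =
    if b = a ∧ k = i ∧ l = j then v else s.arr b k l := rfl
@[simp] theorem State.setArr_var : (s.setArr a i j v).var = s.var := rfl
@[simp] theorem State.setArr_rarr : (s.setArr a i j v).rarr = s.rarr := rfl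
@[simp] theorem State.setRVar_rvar : (s.setRVar x r).rvar y = if y = x then r else s.rvar y := rfl
@[simp] theorem State.setRVar_var : (s.setRVar x r).var = s.var := rfl
@[simp] theorem State.setRVar_arr : (s.setRVar x r).arr = s.arr := rfl
@[simp] theorem State.setRArr_rarr : (s.setRArr a i j r).rarr b k l =
    if b = a ∧ k = i ∧ l = j then r else s.rarr b k l := rfl
@[simp] theorem State.setRArr_var : (s.setRArr a i j r).var = s.var := rfl

variable (p q : Code) (t : Test) (e f g : NExp) (h : RExp)

@[simp] theorem run_skip : Code.skip.run s = s := rfl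
@[simp] theorem run_set : (Code.set x e).run s = s.setVar x (e.eval s) := rfl
@[simp] theorem run_put :
    (Code.put a e f g).run s = s.setArr a (e.eval s) (f.eval s) (g.eval s) := rfl
@[simp] theorem run_rset : (Code.rset x h).run s = s.setRVar x (h.eval s) := rfl
@[simp] theorem run_rput :
    (Code.rput a e f h).run s = s.setRArr a (e.eval s) (f.eval s) (h.eval s) := rfl
@[simp] theorem run_seq : (Code.seq p q).run s = q.run (p.run s) := rfl

open Classical in
@[simp] theorem run_ite : (Code.ite t p q).run s = if t.Holds s then p.run s else q.run s := by
  simp only [Code.run]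

end Simp

attribute [simp] NExp.eval RExp.eval Test.Holds

section Comparison

/-- Whether the row `i` (variable `7`) is labelled. -/
def labelled : Test := .neq (.get 0 (.var 7) (.const 0)) (.const 1)

/-- Compares the columns in the variables `5` and `6`, on the labelled rows (result in
variable `8`) and on the unlabelled rows up to variable `2` (result in variable `9`). -/
def compareAt : Code :=
  .seq (.set 8 (.const 1)) <| .seq (.set 9 (.const 1)) <|
    .loop 7 0 <|
      .ite (.req (.get 0 (.var 7) (.var 5)) (.get 0 (.var 7) (.var 6))) .skip <|
        .ite labelled (.set 8 (.const 0)) <|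
          .ite (.nle (.var 7) (.var 2)) (.set 9 (.const 0)) .skip

/-- Compares all pairs of columns; the results are in the arrays `1` and `2`. -/
def compareAll : Code :=
  .loop 5 1 <| .loop 6 1 <| .seq compareAt <|
    .seq (.put 1 (.var 5) (.var 6) (.var 8)) (.put 2 (.var 5) (.var 6) (.var 9))

theorem forall_lt_succ {p : ℕ → Prop} {k : ℕ} : (∀ x < k + 1, p x) ↔ (∀ x < k, p x) ∧ p k := by
  constructor
  · exact fun h => ⟨fun x hx => h x (by omega), h k (by omega)⟩
  · intro h x hx
    rcases Nat.lt_succ_iff_lt_or_eq.1 hx with hx | rfl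
    exacts [h.1 x hx, h.2]

theorem compareAt_spec (s : State) :
    ((compareAt.run s).var 8 = 1 ↔ ∀ i < s.var 0, s.arr 0 i 0 = 1 →
      s.rarr 0 i (s.var 5) = s.rarr 0 i (s.var 6)) ∧
    ((compareAt.run s).var 9 = 1 ↔ ∀ i < s.var 0, s.arr 0 i 0 ≠ 1 → i ≤ s.var 2 →
      s.rarr 0 i (s.var 5) = s.rarr 0 i (s.var 6)) := by
  refine loop_induction (s := (s.setVar 8 1).setVar 9 1) (fun k s' =>
    (s'.var 8 = 1 ↔ ∀ i < k, s.arr 0 i 0 = 1 → s.rarr 0 i (s.var 5) = s.rarr 0 i (s.var 6)) ∧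
    (s'.var 9 = 1 ↔ ∀ i < k, s.arr 0 i 0 ≠ 1 → i ≤ s.var 2 →
      s.rarr 0 i (s.var 5) = s.rarr 0 i (s.var 6))) (by simp) ?_
  intro k hk s' hF hc ih
  have h2 := hF.var 2 (by decide)
  have h5 := hF.var 5 (by decide)
  have h6 := hF.var 6 (by decide)
  have ha := hF.arr 0 (by decide)
  have hr := hF.rarr 0 (by decide)
  simp only [State.setVar_var, State.setVar_arr, State.setVar_rarr] at h2 h5 h6 ha hr
  simp only [forall_lt_succ, ← ih.1, ← ih.2]
  by_cases e : s.rarr 0 k (s.var 5) = s.rarr 0 k (s.var 6)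
  · simp [hc, h5, h6, hr, e]
  · by_cases hl : s.arr 0 k 0 = 1
    · simp [hc, h5, h6, hr, ha, e, hl, labelled]
    · by_cases hv : k ≤ s.var 2
      · simp [hc, h5, h6, hr, ha, e, hl, labelled, hv, h2]
      · simp [hc, h5, h6, hr, ha, e, hl, labelled, hv, h2]

theorem compareAll_spec (s : State) : ∀ x < s.var 1, ∀ y < s.var 1,
    ((compareAll.run s).arr 1 x y = 1 ↔ ∀ i < s.var 0, s.arr 0 i 0 = 1 →
      s.rarr 0 i x = s.rarr 0 i y) ∧
    ((compareAll.run s).arr 2 x y = 1 ↔ ∀ i < s.var 0, s.arr 0 i 0 ≠ 1 → i ≤ s.var 2 →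
      s.rarr 0 i x = s.rarr 0 i y) := by
  set P : State → ℕ → ℕ → Prop := fun s' x y =>
    (s'.arr 1 x y = 1 ↔ ∀ i < s.var 0, s.arr 0 i 0 = 1 → s.rarr 0 i x = s.rarr 0 i y) ∧
    (s'.arr 2 x y = 1 ↔ ∀ i < s.var 0, s.arr 0 i 0 ≠ 1 → i ≤ s.var 2 →
      s.rarr 0 i x = s.rarr 0 i y) with hP
  refine loop_induction (s := s) (fun k s' => ∀ x < k, ∀ y < s.var 1, P s' x y) (by simp) ?_
  intro k hk s' hF hc ih
  -- The inner invariant covers the pairs with first column before `k` and the pairs of `k` with the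
  -- first `l` columns.
  have h := loop_induction (c := 6) (b := 1) (s := s')
    (p := .seq compareAt <|
      .seq (.put 1 (.var 5) (.var 6) (.var 8)) (.put 2 (.var 5) (.var 6) (.var 9)))
    (fun l s'' => (∀ x < k, ∀ y < s.var 1, P s'' x y) ∧ ∀ y < l, P s'' k y)
    ⟨ih, by simp⟩ ?_
  · rw [hF.var 1 (by decide)] at h
    exact forall_lt_succ.2 h
  · intro l hl s'' hF' hc' ih'
    have e0 := (hF'.var 0 (by decide)).trans (hF.var 0 (by decide))
    have e2 := (hF'.var 2 (by decide)).trans (hF.var 2 (by decide))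
    have e5 := (hF'.var 5 (by decide)).trans hc
    have ea := (hF'.arr 0 (by decide)).trans (hF.arr 0 (by decide))
    have er := (hF'.rarr 0 (by decide)).trans (hF.rarr 0 (by decide))
    have hs := compareAt_spec s''
    have hf := frame_run compareAt s''
    have f5 := (hf.var 5 (by decide)).trans e5
    have f6 := (hf.var 6 (by decide)).trans hc'
    have f1 := hf.arr 1 (by decide)
    have f2 := hf.arr 2 (by decide)
    rw [e0, e2, e5, hc', ea, er] at hs
    rw [forall_lt_succ]
    refine ⟨fun x hx y hy => ?_, fun y hy => ?_, ?_⟩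
    · have := ih'.1 x hx y hy
      simpa [hP, f5, f6, f1, f2, hx.ne] using this
    · have := ih'.2 y hy
      simpa [hP, f5, f6, f1, f2, hy.ne] using this
    · simpa [hP, f5, f6] using hs

end Comparison

section IndependenceTest

/-- Counts the columns that agree with column `a` (variable `5`) on the first set of rows, with
column `b` (variable `6`) on the second set, and with both. -/
def countPairs : Code :=
  .seq (.rset 0 .zero) <| .seq (.rset 1 .zero) <| .seq (.rset 2 .zero) <| .seq (.rset 3 .zero) <|
    .loop 7 1 <|
      .seq (.rset 3 (.add (.var 3) .one)) <|
      .seq (.ite (.neq (.get 1 (.var 7) (.var 5)) (.const 1))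
        (.rset 0 (.add (.var 0) .one)) .skip) <|
      .seq (.ite (.neq (.get 2 (.var 7) (.var 6)) (.const 1))
        (.rset 1 (.add (.var 1) .one)) .skip) <|
      .ite (.and (.neq (.get 1 (.var 7) (.var 5)) (.const 1))
        (.neq (.get 2 (.var 7) (.var 6)) (.const 1))) (.rset 2 (.add (.var 2) .one)) .skip

/-- Tests independence by means of the arrays `1` and `2`; variable `10` is `0` if it holds. -/
def testIndep : Code :=
  .seq (.set 10 (.const 0)) <| .loop 5 1 <| .loop 6 1 <| .seq countPairs <|
    .ite (.req (.mul (.var 2) (.var 3)) (.mul (.var 0) (.var 1))) .skip (.set 10 (.const 1))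

/-- The counts are kept in real variables because they must be multiplied, which natural-number
expressions cannot do. Real variable `3` produces `n` as a real number. -/
theorem countPairs_spec (s : State) :
    (countPairs.run s).rvar 0 = cnt (fun x => s.arr 1 x (s.var 5) = 1) (s.var 1) ∧
    (countPairs.run s).rvar 1 = cnt (fun x => s.arr 2 x (s.var 6) = 1) (s.var 1) ∧
    (countPairs.run s).rvar 2 =
      cnt (fun x => s.arr 1 x (s.var 5) = 1 ∧ s.arr 2 x (s.var 6) = 1) (s.var 1) ∧
    (countPairs.run s).rvar 3 = s.var 1 := by
  refine loop_induction (s := (((s.setRVar 0 0).setRVar 1 0).setRVar 2 0).setRVar 3 0)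
    (fun k s' => s'.rvar 0 = cnt (fun x => s.arr 1 x (s.var 5) = 1) k ∧
      s'.rvar 1 = cnt (fun x => s.arr 2 x (s.var 6) = 1) k ∧
      s'.rvar 2 = cnt (fun x => s.arr 1 x (s.var 5) = 1 ∧ s.arr 2 x (s.var 6) = 1) k ∧
      s'.rvar 3 = k) (by simp [cnt_zero]) ?_
  intro k hk s' hF hc ⟨i0, i1, i2, i3⟩
  have h5 := hF.var 5 (by decide)
  have h6 := hF.var 6 (by decide)
  have a1 := hF.arr 1 (by decide)
  have a2 := hF.arr 2 (by decide)
  simp only [State.setRVar_var, State.setRVar_arr] at h5 h6 a1 a2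
  by_cases c1 : s.arr 1 k (s.var 5) = 1 <;> by_cases c2 : s.arr 2 k (s.var 6) = 1 <;>
    simp [hc, h5, h6, a1, a2, c1, c2, i0, i1, i2, i3, cnt_succ_of_pos, cnt_succ_of_neg]

theorem testIndep_spec (s : State) : (testIndep.run s).var 10 = 0 ↔
    ∀ a < s.var 1, ∀ b < s.var 1,
      cnt (fun x => s.arr 1 x a = 1 ∧ s.arr 2 x b = 1) (s.var 1) * s.var 1 =
        cnt (fun x => s.arr 1 x a = 1) (s.var 1) * cnt (fun x => s.arr 2 x b = 1) (s.var 1) := by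
  set P : ℕ → ℕ → Prop := fun a b =>
    cnt (fun x => s.arr 1 x a = 1 ∧ s.arr 2 x b = 1) (s.var 1) * s.var 1 =
      cnt (fun x => s.arr 1 x a = 1) (s.var 1) * cnt (fun x => s.arr 2 x b = 1) (s.var 1) with hP
  refine loop_induction (s := s.setVar 10 0)
    (fun k s' => s'.var 10 = 0 ↔ ∀ a < k, ∀ b < s.var 1, P a b) (by simp) ?_
  intro k hk s' hF hc ih
  have h := loop_induction (c := 6) (b := 1) (s := s')
    (p := .seq countPairs <|
      .ite (.req (.mul (.var 2) (.var 3)) (.mul (.var 0) (.var 1))) .skip (.set 10 (.const 1)))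
    (fun l s'' => s''.var 10 = 0 ↔ (∀ a < k, ∀ b < s.var 1, P a b) ∧ ∀ b < l, P k b)
    (by simpa using ih) ?_
  · rw [hF.var 1 (by decide)] at h
    rw [forall_lt_succ]
    exact h
  · intro l hl s'' hF' hc' ih'
    have e1 := (hF'.var 1 (by decide)).trans (hF.var 1 (by decide))
    have e5 := (hF'.var 5 (by decide)).trans hc
    have a1 := (hF'.arr 1 (by decide)).trans (hF.arr 1 (by decide))
    have a2 := (hF'.arr 2 (by decide)).trans (hF.arr 2 (by decide))
    simp only [State.setVar_var, State.setVar_arr] at e1 a1 a2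
    obtain ⟨r0, r1, r2, r3⟩ := countPairs_spec s''
    have f10 := (frame_run countPairs s'').var 10 (by decide)
    simp only [e1, e5, hc', a1, a2] at r0 r1 r2 r3
    have hR : (Test.req (.mul (.var 2) (.var 3)) (.mul (.var 0) (.var 1))).Holds
        (countPairs.run s'') ↔ P k l := by
      simp only [Test.Holds, RExp.eval, r0, r1, r2, r3, hP]
      exact_mod_cast Iff.rfl
    rw [forall_lt_succ, ← and_assoc, ← ih', run_seq, run_ite]
    by_cases h : P k l
    · rw [if_pos (hR.2 h)]
      simp [f10, h]
    · rw [if_neg fun h' => h (hR.1 h')]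
      simp [h]

end IndependenceTest

end RealRAM

/-! ### Growing the indecomposable block of row 0. -/

namespace RealRAM

open Code

section Growth

/-- The labelled rows. -/
def State.rowsIn (s : State) : Finset ℕ := (Finset.range (s.var 0)).filter fun i => s.arr 0 i 0 = 1

/-- The unlabelled rows up to `v`. -/
def State.rowsOut (s : State) (v : ℕ) : Finset ℕ :=
  (Finset.range (s.var 0)).filter fun i => s.arr 0 i 0 ≠ 1 ∧ i ≤ v

theorem State.mem_rowsIn {s : State} {i : ℕ} : i ∈ s.rowsIn ↔ i < s.var 0 ∧ s.arr 0 i 0 = 1 := by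
  simp [State.rowsIn]

theorem State.mem_rowsOut {s : State} {v i : ℕ} :
    i ∈ s.rowsOut v ↔ i < s.var 0 ∧ s.arr 0 i 0 ≠ 1 ∧ i ≤ v := by
  simp [State.rowsOut]

theorem State.disjoint_rows (s : State) (v : ℕ) : Disjoint s.rowsIn (s.rowsOut v) :=
  Finset.disjoint_left.2 fun _ h h' => (mem_rowsOut.1 h').2.1 (mem_rowsIn.1 h).2

theorem State.rowsOut_eq_sdiff (s : State) {v : ℕ} (hv : s.var 0 ≤ v + 1) :
    s.rowsOut v = Finset.range (s.var 0) \ s.rowsIn := by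
  ext i
  simp only [mem_rowsOut, mem_rowsIn, Finset.mem_sdiff, Finset.mem_range]
  constructor
  · rintro ⟨h1, h2, _⟩
    exact ⟨h1, fun h => h2 h.2⟩
  · rintro ⟨h1, h2⟩
    exact ⟨h1, fun h => h2 ⟨h1, h⟩, by omega⟩

theorem State.rowsIn_congr {s s' : State} (h0 : s'.var 0 = s.var 0) (h : s'.arr 0 = s.arr 0) :
    s'.rowsIn = s.rowsIn := by simp [State.rowsIn, h0, h]

theorem State.rowsOut_congr {s s' : State} (h0 : s'.var 0 = s.var 0) (h : s'.arr 0 = s.arr 0) :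
    s'.rowsOut = s.rowsOut := by
  funext v
  simp [State.rowsOut, h0, h]

/-- The independence of the labelled rows from the unlabelled rows up to `v`. -/
def State.Indep (s : State) (v : ℕ) : Prop :=
  RowIndep (s.rarr 0) (s.var 1) s.rowsIn (s.rowsOut v)

/-- Compares the columns and tests independence. -/
def test : Code := .seq compareAll testIndep

/-- By `rowIndep_iff` only values occurring in columns matter, so the pairs of columns suffice as
test cases. -/
theorem test_spec (s : State) : (test.run s).var 10 = 0 ↔ s.Indep (s.var 2) := by
  have h := testIndep_spec (compareAll.run s)
  have h1 := (frame_run compareAll s).var 1 (by decide)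
  have hs := compareAll_spec s
  rw [State.Indep, rowIndep_iff (s.disjoint_rows _), test, run_seq, h, h1]
  have k1 : ∀ x < s.var 1, ∀ y < s.var 1, ((compareAll.run s).arr 1 x y = 1 ↔
      ∀ i ∈ s.rowsIn, s.rarr 0 i x = s.rarr 0 i y) := by
    intro x hx y hy
    rw [(hs x hx y hy).1]
    simp only [State.mem_rowsIn, and_imp]
  have k2 : ∀ x < s.var 1, ∀ y < s.var 1, ((compareAll.run s).arr 2 x y = 1 ↔
      ∀ i ∈ s.rowsOut (s.var 2), s.rarr 0 i x = s.rarr 0 i y) := by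
    intro x hx y hy
    rw [(hs x hx y hy).2]
    simp only [State.mem_rowsOut, and_imp]
  refine forall₂_congr fun a ha => forall₂_congr fun b hb => ?_
  rw [cnt_congr fun x hx => and_congr (k1 x hx a ha) (k2 x hx b hb),
    cnt_congr fun x hx => k1 x hx a ha, cnt_congr fun x hx => k2 x hx b hb]

/-- Finds (in variable `2`) the least `v` such that the labelled rows depend on the unlabelled
rows up to `v`. -/
def scan : Code :=
  .seq (.set 2 (.const 0)) <| .loop 4 0 <| .seq test <|
    .ite (.neq (.var 10) (.const 0)) (.set 2 (.add (.var 2) (.const 1))) .skip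

/-- After the first failed test variable `2` no longer moves, and the remaining rounds repeat the
same failing test. The value `s.var 0` is reached only if all tests succeed. -/
theorem scan_spec (s : State) : (scan.run s).var 2 ≤ s.var 0 ∧
    (∀ u < (scan.run s).var 2, s.Indep u) ∧
    ((scan.run s).var 2 = s.var 0 ∨ ¬ s.Indep ((scan.run s).var 2)) := by
  refine loop_induction (s := s.setVar 2 0)
    (fun k s' => s'.var 2 ≤ k ∧ (∀ u < s'.var 2, s.Indep u) ∧
      (s'.var 2 = k ∨ ¬ s.Indep (s'.var 2))) (by simp) ?_
  intro k hk s' hF hc ⟨h1, h2, h3⟩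
  have e0 := hF.var 0 (by decide)
  have e1 := hF.var 1 (by decide)
  have a0 := hF.arr 0 (by decide)
  have r0 := hF.rarr 0 (by decide)
  simp only [State.setVar_var, State.setVar_arr, State.setVar_rarr] at e0 e1 a0 r0
  have hI : ∀ v, s'.Indep v ↔ s.Indep v := fun v => by
    rw [State.Indep, State.Indep, State.rowsIn_congr e0 a0, State.rowsOut_congr e0 a0, r0]
    simp only [e1, if_neg (by decide : (1 : ℕ) ≠ 2)]
  have ht := test_spec s'
  rw [hI] at ht
  have f2 := (frame_run test s').var 2 (by decide)
  by_cases hi : s.Indep (s'.var 2)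
  · have hk2 : s'.var 2 = k := h3.resolve_right fun h => h hi
    rw [hk2] at hi h2 f2
    rw [hk2] at ht
    simp only [run_seq, run_ite, Test.Holds, NExp.eval, ht.2 hi, if_true, run_set, State.setVar_var,
      f2, if_neg (by decide : (2 : ℕ) ≠ 4)]
    exact ⟨le_rfl, forall_lt_succ.2 ⟨h2, hi⟩, .inl trivial⟩
  · simp [ht, hi, f2]
    exact ⟨by omega, h2⟩

/-- Starting with the row `0`, labels all rows of the indecomposable part that contains it. -/
def grow : Code :=
  .seq (.put 0 (.const 0) (.const 0) (.const 1)) <| .loop 3 0 <| .seq scan <|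
    .put 0 (.var 2) (.const 0) (.const 1)

/-- After `k` rounds the labelled set lies in every splitting set containing row 0, and it either
splits off already or has at least `k + 1` elements. After as many rounds as there are rows, the
second case is impossible. -/
theorem grow_spec (s : State) (hs : ∀ i, s.arr 0 i 0 = 0) (hm : 0 < s.var 0) (hn : 0 < s.var 1) :
    0 ∈ (grow.run s).rowsIn ∧
    RowIndep (s.rarr 0) (s.var 1) (grow.run s).rowsIn
      (Finset.range (s.var 0) \ (grow.run s).rowsIn) ∧
    ∀ Z ⊆ Finset.range (s.var 0), 0 ∈ Z →
      RowIndep (s.rarr 0) (s.var 1) Z (Finset.range (s.var 0) \ Z) →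
      (grow.run s).rowsIn ⊆ Z := by
  have h := loop_induction (c := 3) (b := 0) (s := s.setArr 0 0 0 1)
    (p := .seq scan <| .put 0 (.var 2) (.const 0) (.const 1))
    (fun k s' => 0 ∈ s'.rowsIn ∧
      (RowIndep (s.rarr 0) (s.var 1) s'.rowsIn (Finset.range (s.var 0) \ s'.rowsIn) ∨
        k + 1 ≤ s'.rowsIn.card) ∧
      ∀ Z ⊆ Finset.range (s.var 0), 0 ∈ Z →
        RowIndep (s.rarr 0) (s.var 1) Z (Finset.range (s.var 0) \ Z) → s'.rowsIn ⊆ Z) ?_ ?_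
  · obtain ⟨h1, h2, h3⟩ := h
    refine ⟨h1, h2.resolve_right fun h => ?_, h3⟩
    have := (Finset.card_filter_le (Finset.range ((grow.run s).var 0)) fun i =>
      (grow.run s).arr 0 i 0 = 1)
    rw [(frame_run grow s).var 0 (by decide), Finset.card_range] at this
    have h' : s.var 0 + 1 ≤ (grow.run s).rowsIn.card := h
    rw [State.rowsIn, (frame_run grow s).var 0 (by decide)] at h'
    omega
  · have : ((s.setArr 0 0 0 1).setVar 3 0).rowsIn = {0} := by
      ext i
      simp only [State.mem_rowsIn, State.setVar_var, State.setVar_arr, State.setArr_var,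
        State.setArr_arr, hs, Finset.mem_singleton]
      by_cases hi : i = 0 <;> simp [hi, hm]
    rw [this]
    simp +contextual
  · intro k hk s' hF hc ⟨h1, h2, h3⟩
    have e0 := hF.var 0 (by decide)
    have e1 := hF.var 1 (by decide)
    have r0 := hF.rarr 0 (by decide)
    simp only [State.setArr_var, State.setArr_rarr] at e0 e1 r0
    obtain ⟨g1, g2, g3⟩ := scan_spec s'
    have a0 := (frame_run scan s').arr 0 (by decide)
    have v0 := (frame_run scan s').var 0 (by decide)
    set v := (scan.run s').var 2 with hv
    set s'' := ((Code.seq scan (.put 0 (.var 2) (.const 0) (.const 1))).run s').setVar 3 (k + 1)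
      with hs''
    have hmem : ∀ i, i ∈ s''.rowsIn ↔ i < s.var 0 ∧ (i = v ∨ s'.arr 0 i 0 = 1) := by
      intro i
      rw [State.mem_rowsIn, hs'']
      simp only [run_seq, run_put, State.setVar_var, State.setVar_arr, State.setArr_var,
        State.setArr_arr, NExp.eval, a0, v0, e0, ← hv]
      by_cases hi : i = v <;> simp [hi]
    have hIn : v < s.var 0 → s''.rowsIn = insert v s'.rowsIn := by
      intro hlt
      ext i
      rw [hmem, Finset.mem_insert, State.mem_rowsIn, e0]
      constructor
      · rintro ⟨hi, rfl | h⟩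
        exacts [.inl rfl, .inr ⟨hi, h⟩]
      · rintro (rfl | h)
        exacts [⟨hlt, .inl rfl⟩, ⟨h.1, .inr h.2⟩]
    have hIn' : v = s.var 0 → s''.rowsIn = s'.rowsIn := by
      intro heq
      ext i
      rw [hmem, State.mem_rowsIn, e0]
      refine and_congr_right fun hi => or_iff_right (by omega)
    have hsub : s'.rowsIn ⊆ Finset.range (s.var 0) := by
      rw [← e0]; exact Finset.filter_subset _ _
    have hind : ∀ u, s'.Indep u ↔ RowIndep (s.rarr 0) (s.var 1) s'.rowsIn (s'.rowsOut u) := by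
      intro u
      rw [State.Indep, r0, e1]
    -- When the scan finds no dependence, the label is written just past the last row and `rowsIn`
    -- does not change.
    by_cases hvm : v = s.var 0
    · rw [hIn' hvm]
      refine ⟨h1, .inl ?_, h3⟩
      have := (hind _).1 (g2 (s.var 0 - 1) (by omega))
      rwa [State.rowsOut_eq_sdiff _ (by omega), e0] at this
    · have hlt : v < s.var 0 := by omega
      have hdep : ¬ s'.Indep v := g3.resolve_left (by omega)
      -- By minimality of `v` there is independence up to `v - 1`; for `v = 0` no rows remain.
      have hT : RowIndep (s.rarr 0) (s.var 1) s'.rowsIn ((s'.rowsOut v).erase v) := by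
        rcases Nat.eq_zero_or_pos v with hv0 | hv0
        · have : (s'.rowsOut v).erase v = ∅ := by
            ext i
            simp only [Finset.mem_erase, State.mem_rowsOut, Finset.notMem_empty, iff_false]
            omega
          rw [this]
          exact rowIndep_empty
        · have : (s'.rowsOut v).erase v ⊆ s'.rowsOut (v - 1) := by
            intro i
            simp only [Finset.mem_erase, State.mem_rowsOut]
            rintro ⟨h1, h2, h3, h4⟩
            exact ⟨h2, h3, by omega⟩
          exact ((hind _).1 (g2 (v - 1) (by omega))).mono_right (s'.disjoint_rows _) this
      have hvT : v ∈ s'.rowsOut v := by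
        by_contra hvT
        rw [Finset.erase_eq_of_notMem hvT, ← hind] at hT
        exact hdep hT
      have hvout : v ∉ s'.rowsIn := fun h => Finset.disjoint_left.1 (s'.disjoint_rows v) h hvT
      have hTR : s'.rowsOut v ⊆ Finset.range (s.var 0) := by
        rw [← e0]; exact Finset.filter_subset _ _
      rw [hIn hlt]
      refine ⟨Finset.mem_insert_of_mem h1, .inr ?_, fun Z hZ h0Z hZi => ?_⟩
      · rw [Finset.card_insert_of_notMem hvout]
        rcases h2 with h2 | h2
        · refine absurd ((hind v).2 (h2.mono_right Finset.disjoint_sdiff fun i hi => ?_)) hdep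
          exact Finset.mem_sdiff.2 ⟨hTR hi, Finset.disjoint_right.1 (s'.disjoint_rows v) hi⟩
        · omega
      · have hAZ := h3 Z hZ h0Z hZi
        refine Finset.insert_subset (RowIndep.mem_of_not_insert hn hZi hAZ
          ((Finset.erase_subset _ _).trans hTR) (Finset.mem_range.2 hlt)
          ((s'.disjoint_rows v).mono_right (Finset.erase_subset _ _)) hT ?_) hAZ
        rwa [Finset.insert_erase hvT, ← hind]

end Growth

end RealRAM

/-! ### Selecting the columns of the factors by program. -/

namespace RealRAM

open Code

section Selection

/-- Counts, modulo variable `14`, the columns before the column `x` (variable `5`) which the array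
`E` relates to `x`; the result is in variable `20`. -/
def residue (E : ℕ) : Code :=
  .seq (.set 20 (.const 0)) <| .loop 6 1 <|
    .ite (.and (.nle (.add (.var 6) (.const 1)) (.var 5))
        (.neq (.get E (.var 6) (.var 5)) (.const 1)))
      (.seq (.set 20 (.add (.var 20) (.const 1))) <|
        .ite (.neq (.var 20) (.var 14)) (.set 20 (.const 0)) .skip) .skip

/-- Writes the rows with the property `b` of the column `x` (variable `5`) into the column of the
array `tgt` given by variable `16`. -/
def copyColumn (tgt : ℕ) (b : Test) : Code :=
  .seq (.set 21 (.const 0)) <| .loop 7 0 <|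
    .ite b (.seq (.rput tgt (.var 21) (.var 16) (.get 0 (.var 7) (.var 5)))
      (.set 21 (.add (.var 21) (.const 1)))) .skip

/-- Writes one in `d` (variable `14`) columns of each class of the relation `E` into the
array `tgt`, restricted to the rows with the property `b`. Variable `16` counts these columns, and
variable `17` is `d` times variable `16`. -/
def select (E tgt : ℕ) (b : Test) : Code :=
  .seq (.set 16 (.const 0)) <| .seq (.set 17 (.const 0)) <| .loop 5 1 <|
    .seq (residue E) <| .ite (.neq (.var 20) (.const 0))
      (.seq (copyColumn tgt b) <| .seq (.set 16 (.add (.var 16) (.const 1)))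
        (.set 17 (.add (.var 17) (.var 14)))) .skip

theorem succ_mod_eq {c d : ℕ} (hd : 0 < d) :
    (c + 1) % d = if c % d + 1 = d then 0 else c % d + 1 := by
  have h1 := Nat.mod_lt c hd
  have h2 : c + 1 = d * (c / d) + (c % d + 1) := by rw [← add_assoc, Nat.div_add_mod]
  rw [h2, Nat.mul_add_mod]
  split_ifs with h
  · rw [h, Nat.mod_self]
  · exact Nat.mod_eq_of_lt (by omega)

/-- A counter that wraps around at `d` replaces division. The loop passes over all columns and
ignores those from `x` on, hence the minimum in the invariant. -/
theorem residue_spec (E : ℕ) (s : State) (hd : 0 < s.var 14) (hx : s.var 5 ≤ s.var 1) :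
    ((residue E).run s).var 20 = cnt (fun y => s.arr E y (s.var 5) = 1) (s.var 5) % s.var 14 := by
  have h := loop_induction (c := 6) (b := 1) (s := s.setVar 20 0)
    (p := .ite (.and (.nle (.add (.var 6) (.const 1)) (.var 5))
        (.neq (.get E (.var 6) (.var 5)) (.const 1)))
      (.seq (.set 20 (.add (.var 20) (.const 1))) <|
        .ite (.neq (.var 20) (.var 14)) (.set 20 (.const 0)) .skip) .skip)
    (fun k s' => s'.var 20 =
      cnt (fun y => s.arr E y (s.var 5) = 1) (min k (s.var 5)) % s.var 14)
    (by simp [cnt_zero]) ?_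
  · simp only [State.setVar_var, if_neg (by decide : (1 : ℕ) ≠ 20), min_eq_right hx] at h
    exact h
  · intro k hk s' hF hc ih
    have h5 := hF.var 5 (by simp [Code.vars])
    have h14 := hF.var 14 (by simp [Code.vars])
    have ha := hF.arr E (by simp [Code.arrs])
    simp only [State.setVar_var, State.setVar_arr] at h5 h14 ha
    by_cases hkx : k < s.var 5
    · rw [min_eq_left hkx.le] at ih
      rw [min_eq_left (show k + 1 ≤ s.var 5 from hkx)]
      by_cases he : s.arr E k (s.var 5) = 1
      · rw [cnt_succ_of_pos (p := fun y => s.arr E y (s.var 5) = 1) he, succ_mod_eq hd, ← ih]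
        by_cases hr : s'.var 20 + 1 = s.var 14
        · simp [hc, h5, h14, ha, he, hr, Nat.succ_le_of_lt hkx]
        · simp [hc, h5, h14, ha, he, hr, Nat.succ_le_of_lt hkx]
      · rw [cnt_succ_of_neg (p := fun y => s.arr E y (s.var 5) = 1) he, ← ih]
        simp [hc, h5, ha, he]
    · rw [min_eq_right (by omega)] at ih
      rw [min_eq_right (by omega), ← ih]
      have : ¬ k + 1 ≤ s.var 5 := by omega
      simp [hc, h5, this]

/-- Variable `21` is the rank of the current row among those with `p`, so the rows are packed
without gaps. The second part protects columns written earlier. -/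
theorem copyColumn_spec {tgt : ℕ} (htgt : tgt ≠ 0) (b : Test) (p : ℕ → Prop) (s : State)
    (hb : ∀ s' : State, s'.arr 0 = s.arr 0 → (b.Holds s' ↔ p (s'.var 7))) :
    (∀ i < s.var 0, p i →
      ((copyColumn tgt b).run s).rarr tgt (cnt p i) (s.var 16) = s.rarr 0 i (s.var 5)) ∧
    ∀ j, j ≠ s.var 16 → ∀ k,
      ((copyColumn tgt b).run s).rarr tgt k j = s.rarr tgt k j := by
  have h := loop_induction (c := 7) (b := 0) (s := s.setVar 21 0)
    (p := .ite b (.seq (.rput tgt (.var 21) (.var 16) (.get 0 (.var 7) (.var 5)))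
      (.set 21 (.add (.var 21) (.const 1)))) .skip)
    (fun k s' => s'.var 21 = cnt p k ∧
      (∀ i < k, p i → s'.rarr tgt (cnt p i) (s.var 16) = s.rarr 0 i (s.var 5)) ∧
      ∀ j, j ≠ s.var 16 → ∀ k, s'.rarr tgt k j = s.rarr tgt k j)
    (by simp [cnt_zero]) ?_
  · exact h.2
  · intro k hk s' hF hc ⟨h1, h2, h3⟩
    have h5 := hF.var 5 (by simp [Code.vars])
    have h16 := hF.var 16 (by simp [Code.vars])
    have ha := hF.arr 0 (by simp [Code.arrs])
    have hr := hF.rarr 0 (by simp [Code.rarrs, htgt.symm])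
    simp only [State.setVar_var, State.setVar_arr, State.setVar_rarr] at h5 h16 ha hr
    have hb' := hb s' ha
    rw [hc] at hb'
    by_cases hp : p k
    · rw [run_ite, if_pos (hb'.2 hp)]
      refine ⟨by simp [h1, cnt_succ_of_pos hp], forall_lt_succ.2 ⟨fun i hi hpi => ?_, fun _ => ?_⟩,
        fun j hj l => ?_⟩
      · have := cnt_lt_cnt hi hpi
        simpa [h1, this.ne] using h2 i hi hpi
      · simp [h1, h16, hr, hc, h5]
      · simpa [h16, hj] using h3 j hj l
    · rw [run_ite, if_neg (fun h => hp (hb'.1 h))]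
      refine ⟨by simp [h1, cnt_succ_of_neg hp], forall_lt_succ.2 ⟨fun i hi hpi => ?_,
        fun h => absurd h hp⟩, fun j hj l => ?_⟩
      · simpa using h2 i hi hpi
      · simpa using h3 j hj l

/-- Adding `d` to variable `17` for each selected column yields the number of these columns times
`d` without multiplying natural numbers. -/
theorem select_spec (E : ℕ) {tgt : ℕ} (htgt : tgt ≠ 0) (b : Test) (p : ℕ → Prop) (s : State)
    (hb : ∀ s' : State, s'.arr 0 = s.arr 0 → (b.Holds s' ↔ p (s'.var 7)))
    (hd : 0 < s.var 14) (sel : ℕ → Prop)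
    (hsel : ∀ x < s.var 1, (sel x ↔ s.var 14 ∣ cnt (fun y => s.arr E y x = 1) x)) :
    ((select E tgt b).run s).var 16 = cnt sel (s.var 1) ∧
    ((select E tgt b).run s).var 17 = cnt sel (s.var 1) * s.var 14 ∧
    ∀ x < s.var 1, sel x → ∀ i < s.var 0, p i →
      ((select E tgt b).run s).rarr tgt (cnt p i) (cnt sel x) = s.rarr 0 i x := by
  refine loop_induction (s := (s.setVar 16 0).setVar 17 0)
    (fun k s' => s'.var 16 = cnt sel k ∧ s'.var 17 = cnt sel k * s.var 14 ∧
    ∀ x < k, sel x → ∀ i < s.var 0, p i → s'.rarr tgt (cnt p i) (cnt sel x) = s.rarr 0 i x)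
    (by simp [cnt_zero]) ?_
  intro k hk s' hF hc ⟨h1, h2, h3⟩
  have v0 := hF.var 0 (by simp [Code.vars, residue, copyColumn])
  have v1 := hF.var 1 (by simp [Code.vars, residue, copyColumn])
  have v14 := hF.var 14 (by simp [Code.vars, residue, copyColumn])
  have a0 := hF.arr 0 (by simp [Code.arrs, residue, copyColumn])
  have aE := hF.arr E (by simp [Code.arrs, residue, copyColumn])
  have r0 := hF.rarr 0 (by simp [Code.rarrs, residue, copyColumn, htgt.symm])
  simp only [State.setVar_var, State.setVar_arr, State.setVar_rarr] at v0 v1 v14 a0 aE r0 hk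
  norm_num at v0 v1 v14 hk
  have hres := residue_spec E s' (by rw [v14]; exact hd) (by rw [hc, v1]; exact hk.le)
  rw [hc, aE, v14] at hres
  have hR := frame_run (residue E) s'
  set t := (residue E).run s' with ht
  have t0 := hR.var 0 (by simp [Code.vars, residue])
  have t5 := hR.var 5 (by simp [Code.vars, residue])
  have t14 := hR.var 14 (by simp [Code.vars, residue])
  have t16 := hR.var 16 (by simp [Code.vars, residue])
  have t17 := hR.var 17 (by simp [Code.vars, residue])
  have ta := hR.arr 0 (by simp [Code.arrs, residue])
  have tr := hR.rarr 0 (by simp [Code.rarrs, residue])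
  have tt := hR.rarr tgt (by simp [Code.rarrs, residue])
  by_cases hs : sel k
  · have h20 : t.var 20 = 0 := by
      rw [hres]; exact Nat.mod_eq_zero_of_dvd ((hsel k hk).1 hs)
    obtain ⟨c1, c2⟩ := copyColumn_spec htgt b p t fun u hu => hb u (by rw [hu, ta, a0])
    have hC := frame_run (copyColumn tgt b) t
    have u14 := hC.var 14 (by simp [Code.vars, copyColumn])
    have u16 := hC.var 16 (by simp [Code.vars, copyColumn])
    have u17 := hC.var 17 (by simp [Code.vars, copyColumn])
    rw [run_seq, ← ht, run_ite, if_pos (by simpa using h20)]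
    rw [t16, h1, t0, v0, t5, hc, tr, r0] at c1
    rw [t16, h1, tt] at c2
    refine ⟨?_, ?_, forall_lt_succ.2 ⟨fun x hx hsx i hi hpi => ?_, fun _ i hi hpi => ?_⟩⟩
    · simp [u16, t16, h1, cnt_succ_of_pos hs]
    · simp [u17, t17, h2, u14, t14, v14, cnt_succ_of_pos hs, add_mul]
    · simpa [c2 _ (cnt_lt_cnt hx hsx).ne] using h3 x hx hsx i hi hpi
    · simpa using c1 i hi hpi
  · have h20 : t.var 20 ≠ 0 := by
      rw [hres]; exact fun h => hs ((hsel k hk).2 (Nat.dvd_of_mod_eq_zero h))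
    rw [run_seq, ← ht, run_ite, if_neg (by simpa using h20)]
    refine ⟨?_, ?_, forall_lt_succ.2 ⟨fun x hx hsx i hi hpi => ?_, fun h => absurd h hs⟩⟩
    · simp [t16, h1, cnt_succ_of_neg hs]
    · simp [t17, h2, cnt_succ_of_neg hs]
    · simpa [tt] using h3 x hx hsx i hi hpi

theorem select_columns (E : ℕ) {tgt : ℕ} (htgt : tgt ≠ 0) (b : Test) (p : ℕ → Prop) (s : State)
    (hb : ∀ s' : State, s'.arr 0 = s.arr 0 → (b.Holds s' ↔ p (s'.var 7)))
    (hd : 0 < s.var 14) {A : Finset ℕ} (hA : A ⊆ Finset.range (s.var 0))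
    (hpA : ∀ i < s.var 0, (p i ↔ i ∈ A))
    (hE : ∀ x < s.var 1, ∀ y < s.var 1,
      (s.arr E x y = 1 ↔ colPart (s.rarr 0) A x = colPart (s.rarr 0) A y)) :
    ((select E tgt b).run s).var 16 =
      cnt (Selected (colPart (s.rarr 0) A) (s.var 14)) (s.var 1) ∧
    ((select E tgt b).run s).var 17 =
      cnt (Selected (colPart (s.rarr 0) A) (s.var 14)) (s.var 1) * s.var 14 ∧
    ∀ x < s.var 1, Selected (colPart (s.rarr 0) A) (s.var 14) x → ∀ i ∈ A,
      ((select E tgt b).run s).rarr tgt (cnt (· ∈ A) i)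
        (cnt (Selected (colPart (s.rarr 0) A) (s.var 14)) x) = s.rarr 0 i x := by
  obtain ⟨h1, h2, h3⟩ := select_spec E htgt b p s hb hd
    (Selected (colPart (s.rarr 0) A) (s.var 14)) fun x hx => by
      rw [Selected, cnt_congr fun y hy => (hE y (hy.trans hx) x hx).symm]
  refine ⟨h1, h2, fun x hx hs i hi => ?_⟩
  have him := Finset.mem_range.1 (hA hi)
  rw [← h3 x hx hs i him ((hpA i him).2 hi),
    cnt_congr fun j hj => (hpA j (hj.trans him)).symm]

end Selection

end RealRAM

/-! ### Searching for the factorization and assembling the algorithm. -/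

namespace RealRAM

open Code

section Decomposition

/-- Searches for a factorization of the number of columns and writes the factors into the
arrays `1` and `2`; their numbers of columns are in the variables `18` and `16`. -/
def search : Code :=
  .seq (.set 15 (.const 0)) <| .loop 22 1 <|
    .ite (.neq (.var 15) (.const 0))
      (.seq (.set 14 (.add (.var 22) (.const 1))) <| .seq (select 1 1 labelled) <|
        .ite (.neq (.var 17) (.var 1))
          (.seq (.set 18 (.var 16)) <| .seq (.set 14 (.var 16)) <|
            .seq (select 2 2 (.not labelled)) <|
            .ite (.neq (.var 16) (.add (.var 22) (.const 1))) (.set 15 (.const 1)) .skip)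
          .skip)
      .skip

/-- The first `c₁` columns of `F₁` and the first `c₂` columns of `F₂` are obtained by selecting
columns of `M`, in such proportions that they can form a factorization. -/
def IsSelection (M : ℕ → ℕ → ℝ) (n : ℕ) (A B : Finset ℕ) (c₁ c₂ : ℕ) (F₁ F₂ : ℕ → ℕ → ℝ) : Prop :=
  ∃ d, 0 < d ∧ c₁ = cnt (Selected (colPart M A) d) n ∧ c₁ * d = n ∧
    c₂ = cnt (Selected (colPart M B) c₁) n ∧ c₂ = d ∧
    (∀ x < n, Selected (colPart M A) d x → ∀ i ∈ A,
      F₁ (cnt (· ∈ A) i) (cnt (Selected (colPart M A) d) x) = M i x) ∧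
    ∀ x < n, Selected (colPart M B) c₁ x → ∀ i ∈ B,
      F₂ (cnt (· ∈ B) i) (cnt (Selected (colPart M B) c₁) x) = M i x

/-- Either all `d ≤ k` have failed or a successful selection is frozen by the flag in variable `15`.
`RowIndep.exists_dvd` excludes failure for all `d ≤ n`. Any `d` passing the two counting tests is
good enough, whether or not it is the gcd, by `cnt_selected_fibre_mul`. -/
theorem search_spec (s : State) {A B : Finset ℕ} (hA : A = s.rowsIn)
    (hB : B = Finset.range (s.var 0) \ A) (hn : 0 < s.var 1)
    (hind : RowIndep (s.rarr 0) (s.var 1) A B)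
    (hE₁ : ∀ x < s.var 1, ∀ y < s.var 1,
      (s.arr 1 x y = 1 ↔ colPart (s.rarr 0) A x = colPart (s.rarr 0) A y))
    (hE₂ : ∀ x < s.var 1, ∀ y < s.var 1,
      (s.arr 2 x y = 1 ↔ colPart (s.rarr 0) B x = colPart (s.rarr 0) B y)) :
    IsSelection (s.rarr 0) (s.var 1) A B ((search.run s).var 18) ((search.run s).var 16)
      ((search.run s).rarr 1) ((search.run s).rarr 2) := by
  have hAm : A ⊆ Finset.range (s.var 0) := hA ▸ Finset.filter_subset _ _
  have hBm : B ⊆ Finset.range (s.var 0) := hB ▸ Finset.sdiff_subset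
  have hpA : ∀ i < s.var 0, (s.arr 0 i 0 = 1 ↔ i ∈ A) := fun i hi => by
    rw [hA, State.mem_rowsIn]; simp [hi]
  have hpB : ∀ i < s.var 0, (¬ s.arr 0 i 0 = 1 ↔ i ∈ B) := fun i hi => by
    rw [hB, Finset.mem_sdiff, ← hpA i hi]; simp [hi]
  have h := loop_induction (c := 22) (b := 1) (s := s.setVar 15 0)
    (p := .ite (.neq (.var 15) (.const 0))
      (.seq (.set 14 (.add (.var 22) (.const 1))) <| .seq (select 1 1 labelled) <|
        .ite (.neq (.var 17) (.var 1))
          (.seq (.set 18 (.var 16)) <| .seq (.set 14 (.var 16)) <|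
            .seq (select 2 2 (.not labelled)) <|
            .ite (.neq (.var 16) (.add (.var 22) (.const 1))) (.set 15 (.const 1)) .skip)
          .skip)
      .skip)
    (fun k s' =>
      (s'.var 15 = 0 ∧ ∀ d, 0 < d → d ≤ k →
        ¬ (cnt (Selected (colPart (s.rarr 0) A) d) (s.var 1) * d = s.var 1 ∧
          cnt (Selected (colPart (s.rarr 0) B)
            (cnt (Selected (colPart (s.rarr 0) A) d) (s.var 1))) (s.var 1) = d)) ∨
      (s'.var 15 ≠ 0 ∧ IsSelection (s.rarr 0) (s.var 1) A B (s'.var 18) (s'.var 16)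
        (s'.rarr 1) (s'.rarr 2))) (.inl ⟨by simp, fun d h h' => by omega⟩) ?_
  · rcases h with ⟨-, h⟩ | ⟨-, h⟩
    · obtain ⟨d, hd, h1, h2⟩ := hind.exists_dvd hn (hB ▸ Finset.disjoint_sdiff)
      -- The search range suffices: `d` is itself a number of selected columns, hence at most `n`.
      exact absurd ⟨h1, h2⟩ (h d hd (h2 ▸ cnt_le _ _))
    · exact h
  · intro k hk s' hF hc ih
    rcases ih with ⟨h15, ih⟩ | ⟨h15, ih⟩
    swap
    · exact .inr (by simpa [h15] using ih)
    have v0 := hF.var 0 (by decide)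
    have v1 := hF.var 1 (by decide)
    have a0 := hF.arr 0 (by decide)
    have a1 := hF.arr 1 (by decide)
    have a2 := hF.arr 2 (by decide)
    have r0 := hF.rarr 0 (by decide)
    simp only [State.setVar_var, State.setVar_arr, State.setVar_rarr] at v0 v1 a0 a1 a2 r0
    norm_num at v0 v1
    set s₁ := s'.setVar 14 (k + 1) with hs₁
    have e0 : s₁.var 0 = s.var 0 := by simp [hs₁, v0]
    have e1 : s₁.var 1 = s.var 1 := by simp [hs₁, v1]
    have e14 : s₁.var 14 = k + 1 := by simp [hs₁]
    have ea0 : s₁.arr 0 = s.arr 0 := by simp [hs₁, a0]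
    have ea1 : s₁.arr 1 = s.arr 1 := by simp [hs₁, a1]
    have ea2 : s₁.arr 2 = s.arr 2 := by simp [hs₁, a2]
    have er0 : s₁.rarr 0 = s.rarr 0 := by simp [hs₁, r0]
    obtain ⟨p1, p2, p3⟩ := select_columns 1 one_ne_zero labelled (fun i => s.arr 0 i 0 = 1) s₁
      (fun u hu => by simp [labelled, hu, ea0]) (by rw [e14]; omega) (A := A) (by rwa [e0])
      (by rwa [e0]) (by rwa [e1, ea1, er0])
    rw [e1, e14, er0] at p1 p2 p3
    have hT := frame_run (select 1 1 labelled) s₁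
    set t := (select 1 1 labelled).run s₁ with ht
    set c := cnt (Selected (colPart (s.rarr 0) A) (k + 1)) (s.var 1) with hcc
    have t0 := (hT.var 0 (by decide)).trans e0
    have t1 := (hT.var 1 (by decide)).trans e1
    have t15 := hT.var 15 (by decide)
    have t22 := hT.var 22 (by decide)
    have ta0 := (hT.arr 0 (by decide)).trans ea0
    have ta2 := (hT.arr 2 (by decide)).trans ea2
    have tr0 := (hT.rarr 0 (by decide)).trans er0
    simp only [hs₁, State.setVar_var] at t15 t22
    norm_num at t15 t22
    have hfail : ¬ (c * (k + 1) = s.var 1 ∧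
        cnt (Selected (colPart (s.rarr 0) B) c) (s.var 1) = k + 1) →
        ∀ d, 0 < d → d ≤ k + 1 →
        ¬ (cnt (Selected (colPart (s.rarr 0) A) d) (s.var 1) * d = s.var 1 ∧
          cnt (Selected (colPart (s.rarr 0) B)
            (cnt (Selected (colPart (s.rarr 0) A) d) (s.var 1))) (s.var 1) = d) := by
      intro h d hd hdk
      rcases Nat.lt_succ_iff_lt_or_eq.1 (Nat.lt_succ_of_le hdk) with hlt | rfl
      exacts [ih d hd (by omega), h]
    rw [run_ite, if_pos (by simpa using h15), run_seq, run_set]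
    simp only [NExp.eval, hc]
    rw [← hs₁, run_seq, ← ht, run_ite]
    by_cases hck : c * (k + 1) = s.var 1
    swap
    · rw [if_neg (by simpa [p2, t1] using hck)]
      exact .inl ⟨by simp [t15, h15], hfail fun h => hck h.1⟩
    rw [if_pos (by simpa [p2, t1] using hck), run_seq, run_set, run_seq, run_set]
    simp only [NExp.eval, State.setVar_var, p1]
    norm_num only [if_true, if_false]
    set s₂ := (t.setVar 18 c).setVar 14 c with hs₂
    have hc0 : 0 < c := Nat.pos_of_ne_zero fun h => by rw [h, zero_mul] at hck; omega
    have g0 : s₂.var 0 = s.var 0 := by simp [hs₂, t0]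
    have g1 : s₂.var 1 = s.var 1 := by simp [hs₂, t1]
    have g14 : s₂.var 14 = c := by simp [hs₂]
    have g15 : s₂.var 15 = 0 := by simp [hs₂, t15, h15]
    have g18 : s₂.var 18 = c := by simp [hs₂]
    have g22 : s₂.var 22 = k := by simp [hs₂, t22, hc]
    have ga0 : s₂.arr 0 = s.arr 0 := by simp [hs₂, ta0]
    have ga2 : s₂.arr 2 = s.arr 2 := by simp [hs₂, ta2]
    have gr0 : s₂.rarr 0 = s.rarr 0 := by simp [hs₂, tr0]
    have gr1 : s₂.rarr 1 = t.rarr 1 := by simp [hs₂]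
    obtain ⟨q1, q2, q3⟩ := select_columns 2 two_ne_zero (.not labelled)
      (fun i => ¬ s.arr 0 i 0 = 1) s₂
      (fun u hu => by simp [labelled, hu, ga0]) (by rwa [g14]) (A := B) (by rwa [g0])
      (by rwa [g0]) (by rwa [g1, ga2, gr0])
    rw [g1, g14, gr0] at q1 q2 q3
    have hU := frame_run (select 2 2 (.not labelled)) s₂
    set u := (select 2 2 (.not labelled)).run s₂ with hu
    have u15 := (hU.var 15 (by decide)).trans g15
    have u18 := (hU.var 18 (by decide)).trans g18
    have u22 := (hU.var 22 (by decide)).trans g22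
    have ur1 := (hU.rarr 1 (by decide)).trans gr1
    rw [run_seq, ← hu, run_ite]
    by_cases hcd : cnt (Selected (colPart (s.rarr 0) B) c) (s.var 1) = k + 1
    · rw [if_pos (by simp [q1, u22, hcd])]
      refine .inr ⟨by simp, k + 1, by omega, ?_, ?_, ?_, ?_, ?_, ?_⟩
      · simp [u18, hcc]
      · simp [u18, hck]
      · simp [u18, q1]
      · simp [q1, hcd]
      · simpa [ur1] using p3
      · simpa [u18] using q3
    · rw [if_neg (by simpa [q1, u22] using hcd)]
      exact .inl ⟨by simp [u15], hfail fun h => hcd h.2⟩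

/-- Counts the labelled rows (variable `12`) and the other rows (variable `13`). -/
def countRows : Code :=
  .seq (.set 12 (.const 0)) <| .seq (.set 13 (.const 0)) <| .loop 7 0 <|
    .ite labelled (.set 12 (.add (.var 12) (.const 1))) (.set 13 (.add (.var 13) (.const 1)))

theorem countRows_spec (s : State) :
    (countRows.run s).var 12 = cnt (fun i => s.arr 0 i 0 = 1) (s.var 0) ∧
    (countRows.run s).var 13 = cnt (fun i => ¬ s.arr 0 i 0 = 1) (s.var 0) := by
  refine loop_induction (s := (s.setVar 12 0).setVar 13 0)
    (fun k s' => s'.var 12 = cnt (fun i => s.arr 0 i 0 = 1) k ∧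
      s'.var 13 = cnt (fun i => ¬ s.arr 0 i 0 = 1) k) (by simp [cnt_zero]) ?_
  intro k hk s' hF hc ⟨h1, h2⟩
  have a0 := hF.arr 0 (by decide)
  simp only [State.setVar_arr] at a0
  by_cases hl : s.arr 0 k 0 = 1 <;>
    simp [labelled, hc, a0, hl, h1, h2, cnt_succ_of_pos, cnt_succ_of_neg]

/-- Splits off the indecomposable part that contains the row `0`, and factorizes the matrix if
other rows are left. -/
def decompose : Code :=
  .seq grow <| .seq (.set 2 (.var 0)) <| .seq compareAll <| .seq countRows <|
    .ite (.neq (.var 13) (.const 0)) .skip search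

/-- Minimality of `A` makes variable `13` decisive: if no rows remain outside `A`, every splitting
set containing row 0 is everything. -/
theorem decompose_spec (s : State) (hs : ∀ i, s.arr 0 i 0 = 0) (hm : 0 < s.var 0)
    (hn : 0 < s.var 1) :
    ∃ A ⊆ Finset.range (s.var 0), 0 ∈ A ∧
      RowIndep (s.rarr 0) (s.var 1) A (Finset.range (s.var 0) \ A) ∧
      (∀ Z ⊆ Finset.range (s.var 0), 0 ∈ Z →
        RowIndep (s.rarr 0) (s.var 1) Z (Finset.range (s.var 0) \ Z) → A ⊆ Z) ∧
      (decompose.run s).var 12 = cnt (· ∈ A) (s.var 0) ∧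
      (decompose.run s).var 13 = cnt (· ∈ Finset.range (s.var 0) \ A) (s.var 0) ∧
      ((decompose.run s).var 13 ≠ 0 →
        IsSelection (s.rarr 0) (s.var 1) A (Finset.range (s.var 0) \ A)
          ((decompose.run s).var 18) ((decompose.run s).var 16)
          ((decompose.run s).rarr 1) ((decompose.run s).rarr 2)) := by
  obtain ⟨h0, hind, hmin⟩ := grow_spec s hs hm hn
  have hG := frame_run grow s
  set g := grow.run s with hg
  have g0 := hG.var 0 (by decide)
  have g1 := hG.var 1 (by decide)
  have gr := hG.rarr 0 (by decide)
  -- With variable `2` set to the number of rows, the second comparison covers all unlabelled rows.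
  have hC := compareAll_spec (g.setVar 2 (s.var 0))
  have hCF := frame_run compareAll (g.setVar 2 (s.var 0))
  set c := compareAll.run (g.setVar 2 (s.var 0)) with hc
  have c0 := hCF.var 0 (by decide)
  have c1 := hCF.var 1 (by decide)
  have ca := hCF.arr 0 (by decide)
  have cr := hCF.rarr 0 (by decide)
  simp only [State.setVar_var, State.setVar_arr, State.setVar_rarr] at hC c0 c1 ca cr
  norm_num at c0 c1 hC
  rw [g0] at c0
  rw [g1] at c1
  rw [gr] at cr
  obtain ⟨k1, k2⟩ := countRows_spec c
  have hKF := frame_run countRows c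
  set k := countRows.run c with hk
  have k0 := (hKF.var 0 (by decide)).trans c0
  have k1' := (hKF.var 1 (by decide)).trans c1
  have ka0 := (hKF.arr 0 (by decide)).trans ca
  have ka1 := hKF.arr 1 (by decide)
  have ka2 := hKF.arr 2 (by decide)
  have kr := (hKF.rarr 0 (by decide)).trans cr
  rw [ca, c0] at k1 k2
  have hrun : decompose.run s = if k.var 13 = 0 then k else search.run k := by
    simp only [decompose, run_seq, run_set, NExp.eval, run_ite, Test.Holds, run_skip]
    rw [← hg, g0, ← hc, ← hk]
    congr
  have hSF := frame_run search k
  have hv12 : (decompose.run s).var 12 = k.var 12 := by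
    rw [hrun]; split_ifs
    exacts [rfl, hSF.var 12 (by decide)]
  have hv13 : (decompose.run s).var 13 = k.var 13 := by
    rw [hrun]; split_ifs
    exacts [rfl, hSF.var 13 (by decide)]
  have hkA : k.rowsIn = g.rowsIn := State.rowsIn_congr (k0.trans g0.symm) ka0
  have hA : ∀ i < s.var 0, (g.arr 0 i 0 = 1 ↔ i ∈ g.rowsIn) := fun i hi => by
    rw [State.mem_rowsIn, g0]; simp [hi]
  have hB : ∀ i < s.var 0, (¬ g.arr 0 i 0 = 1 ↔ i ∈ Finset.range (s.var 0) \ g.rowsIn) :=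
    fun i hi => by rw [Finset.mem_sdiff, ← hA i hi]; simp [hi]
  refine ⟨g.rowsIn, ?_, h0, hind, hmin, ?_, ?_, fun h13 => ?_⟩
  · rw [← g0]; exact Finset.filter_subset _ _
  · rw [hv12, k1]; exact cnt_congr hA
  · rw [hv13, k2]; exact cnt_congr hB
  · rw [hv13] at h13
    rw [hrun, if_neg h13]
    have := search_spec k (A := g.rowsIn) (B := Finset.range (s.var 0) \ g.rowsIn) hkA.symm
      (by rw [k0]) (by rwa [k1']) (by rwa [kr, k1']) ?_ ?_
    · rwa [kr, k1'] at this
    · intro x hx y hy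
      rw [k1'] at hx hy
      rw [ka1, kr, colPart_eq_iff, (hC x (by rwa [g1]) y (by rwa [g1])).1, g0, gr]
      simp only [State.mem_rowsIn, g0, and_imp]
    · intro x hx y hy
      rw [k1'] at hx hy
      rw [ka2, kr, colPart_eq_iff, (hC x (by rwa [g1]) y (by rwa [g1])).2, g0, gr]
      constructor
      · intro h i hi
        have him := Finset.mem_range.1 (Finset.mem_sdiff.1 hi).1
        exact h i him ((hB i him).2 hi) him.le
      · intro h i hi hl _
        exact h i ((hB i hi).1 hl)

end Decomposition

end RealRAM

/-! ### Reporting the answer, and the theorem. -/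

namespace RealRAM

section Recognition

/-- Moves the answer of `decompose` into the variables `0`, …, `4`. -/
def report : Program :=
  .ite (.neq (.var 13) (.const 0)) (.set 0 (.const 0)) <|
    .seq (.set 0 (.const 1)) <| .seq (.set 1 (.var 12)) <| .seq (.set 2 (.var 18)) <|
      .seq (.set 3 (.var 13)) (.set 4 (.var 16))

/-- Recognizes 1-products and factorizes them. -/
def recognize : Program :=
  .ite (.and (.nle (.const 1) (.var 0)) (.nle (.const 1) (.var 1)))
    (.seq decompose.compile report) (.set 0 (.const 0))

/-- The test costs 3 and each assignment 2; the longer branch has five assignments, which gives 13.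
-/
theorem exec_report_of_eq {s : State} (h : s.var 13 = 0) :
    ∃ t ≤ 13, Exec report s t (s.setVar 0 0) :=
  ⟨3 + 2, by omega, .iteTrue (by simpa using h) (.set _ _ _)⟩

theorem exec_report_of_ne {s : State} (h : s.var 13 ≠ 0) :
    ∃ t ≤ 13, ∃ s', Exec report s t s' ∧ s'.var 0 = 1 ∧ s'.var 1 = s.var 12 ∧
      s'.var 2 = s.var 18 ∧ s'.var 3 = s.var 13 ∧ s'.var 4 = s.var 16 ∧ s'.rarr = s.rarr :=
  ⟨3 + (2 + (2 + (2 + (2 + 2)))), by omega, _, .iteFalse (by simpa using h)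
    (.seq (.set _ _ _) (.seq (.set _ _ _) (.seq (.set _ _ _) (.seq (.set _ _ _) (.set _ _ _))))),
    by simp⟩

end Recognition

end RealRAM

open RealRAM in
theorem correctAnswer_of_not_isOneProduct {m n : ℕ} {S : Matrix (Fin m) (Fin n) ℝ} {s : State}
    (h : ¬ IsOneProduct S) (hs : s.var 0 = 0) : CorrectAnswer S s :=
  ⟨fun _ => hs, fun h' => absurd h' h⟩

open RealRAM in
/-- The answer after `decompose` is correct. -/
theorem exec_report_correct {m n : ℕ} (hm : 0 < m) (hn : 0 < n) (S : Matrix (Fin m) (Fin n) ℝ) :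
    ∃ t ≤ 13, ∃ s, Exec report (decompose.run (input S)) t s ∧ CorrectAnswer S s := by
  obtain ⟨A, hA, h0, hind, hmin, h12, h13, hsel⟩ :=
    decompose_spec (input S) (fun _ => rfl) (by simpa [input] using hm) (by simpa [input] using hn)
  have hM : ∀ (i : Fin m) (j : Fin n), (input S).rarr 0 i j = S i j := fun i j => by
    simp [input]
  have v0 : (input S).var 0 = m := by simp [input]
  have v1 : (input S).var 1 = n := by simp [input]
  rw [v0] at hA hind hmin h12 h13 hsel
  rw [v1] at hind hmin hsel
  by_cases hz : (decompose.run (input S)).var 13 = 0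
  · obtain ⟨t, ht, hE⟩ := exec_report_of_eq hz
    refine ⟨t, ht, _, hE, correctAnswer_of_not_isOneProduct (fun hS => ?_) (by simp)⟩
    -- A proper splitting set `Z` containing row 0 would contain `A`, which consists of all rows,
    -- yet it misses row `i`.
    obtain ⟨-, Z, hZ, hZi, h0Z, i, hi, hiZ⟩ := hS.exists_rowIndep hM
    rw [h13, cnt_eq_zero] at hz
    refine hz i hi (Finset.mem_sdiff.2 ⟨Finset.mem_range.2 hi, fun h => hiZ ?_⟩)
    exact hmin Z hZ h0Z hZi h
  · obtain ⟨t, ht, s, hE, s0, s1, s2, s3, s4, sr⟩ := exec_report_of_ne hz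
    refine ⟨t, ht, s, hE, ?_⟩
    obtain ⟨d, hd, k1, k2, k3, k4, k5, k6⟩ := hsel hz
    have hiso : MatIso S (oneProd (s.matrix 1 (s.var 1) (s.var 2))
        (s.matrix 2 (s.var 3) (s.var 4))) := by
      rw [s1, s2, s3, s4]
      unfold State.matrix
      rw [sr]
      exact matIso_of_selected hM hA rfl hn hind hd k1 k3 h12 h13 k2 k4 k5 k6
    have p1 : 0 < s.var 1 := by
      rw [s1, h12]; exact cnt_pos.2 ⟨0, hm, h0⟩
    have p2 : 0 < s.var 2 := by
      rw [s2]; exact Nat.pos_of_ne_zero fun h => by rw [h, zero_mul] at k2; omega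
    have p3 : 0 < s.var 3 := by
      rw [s3]; exact Nat.pos_of_ne_zero hz
    have p4 : 0 < s.var 4 := by
      rw [s4, k4]; exact hd
    exact ⟨fun h => absurd ⟨_, _, _, _, _, _, p1, p2, p3, p4, hiso⟩ h,
      fun _ => ⟨s0, p1, p2, p3, p4, hiso⟩⟩

theorem theorem1 :
    ∃ (P : RealRAM.Program) (p : MvPolynomial (Fin 2) ℕ),
      ∀ (m n : ℕ) (S : Matrix (Fin m) (Fin n) ℝ),
        ∃ (t : ℕ) (s : RealRAM.State),
          RealRAM.Exec P (RealRAM.input S) t s ∧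
          t ≤ MvPolynomial.eval ![m, n] p ∧
          CorrectAnswer S s := by
  -- The time bound is taken at `m + n`; the additional 20 is 7 for the initial test and 13 for the
  -- report.
  refine ⟨RealRAM.recognize, Polynomial.eval₂ MvPolynomial.C (MvPolynomial.X 0 + MvPolynomial.X 1)
    (RealRAM.decompose.time + 20), fun m n S => ?_⟩
  have heval : MvPolynomial.eval ![m, n] (Polynomial.eval₂ MvPolynomial.C
      (MvPolynomial.X 0 + MvPolynomial.X 1) (RealRAM.decompose.time + 20)) =
      RealRAM.decompose.time.eval (m + n) + 20 := by
    rw [Polynomial.hom_eval₂]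
    have : (MvPolynomial.eval ![m, n]).comp MvPolynomial.C = RingHom.id ℕ :=
      RingHom.ext fun a => MvPolynomial.eval_C a
    rw [this]
    simp [Polynomial.eval₂_id]
  rw [heval]
  have v0 : (RealRAM.input S).var 0 = m := by simp [RealRAM.input]
  have v1 : (RealRAM.input S).var 1 = n := by simp [RealRAM.input]
  by_cases h : 0 < m ∧ 0 < n
  · obtain ⟨t, ht, hE⟩ := RealRAM.Code.exec_compile RealRAM.decompose (by decide) (by decide)
      (by decide) (N := m + n) (RealRAM.input S) (by rw [v0, v1])
    obtain ⟨t', ht', s, hE', hs⟩ := exec_report_correct h.1 h.2 S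
    refine ⟨7 + (t + t'), s, .iteTrue ?_ (.seq hE hE'), by omega, hs⟩
    simp only [RealRAM.Test.Holds, RealRAM.NExp.eval, v0, v1]
    exact h
  -- Without rows or without columns there is no 1-product. This case is kept apart because
  -- `grow_spec` needs a row 0 and a positive number of columns.
  · refine ⟨7 + 2, _, .iteFalse ?_ (.set _ _ _), by omega, ?_⟩
    · simp only [RealRAM.Test.Holds, RealRAM.NExp.eval, v0, v1]
      exact h
    · refine correctAnswer_of_not_isOneProduct (fun hS => h ?_) (by simp)
      obtain ⟨hn, -, -, -, -, i, hi, -⟩ :=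
        hS.exists_rowIndep (M := (RealRAM.input S).rarr 0) fun i j => by simp [RealRAM.input]
      exact ⟨by omega, hn⟩
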